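/- **Setting.** Let $\lambda_1,\dots,\lambda_n>0$ with $\sum_i\lambda_i=n$. For each node $i$ let $\mathcal D_i$ be a probability distribution of samples and $f_i(\theta,\xi)$ a sample loss on $\mathbb R^d$; put $F_i(\theta)=\mathbb E_{\xi\sim\mathcal D_i}[f_i(\theta,\xi)]$ and $F(\theta)=\frac1n\sum_{i=1}^n\lambda_iF_i(\theta)$, and let $\theta^\star$ be a global minimizer of $F$. Assume: 1. each $F_i$ is differentiable and $\|\nabla F_i(\theta_1)-\nabla F_i(\theta_2)\|\le\beta\|\theta_1-\theta_2\|$ for all $\theta_1,\theta_2$, where $\beta>0$; 2. $\mathbb E_{\xi\sim\mathcal D_i}[\nabla f_i(\theta;\xi)]=\nabla F_i(\theta)$ and $\mathbb E_{\xi\sim\mathcal D_i}\|\nabla f_i(\theta;\xi)-\nabla F_i(\theta)\|^2\le\upsilon^2$ for all $i$ and $\theta$; the samples $\xi_i^{(t)}\sim\mathcal D_i$ are independent over all nodes $i$ and iterations $t\ge 0$; 3. the communication graph $\mathcal G$ on $\{1,\dots,n\}$ is connected. Call a matrix $W$ *mixing with weights* $w$ if it is row-stochastic, $W_{i,i}>0$,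 for $i\ne j$ one has $W_{i,j}>0$ exactly when $ij$ is an edge of $\mathcal G$, and $w_iW_{i,j}=w_jW_{j,i}$ for all $i,j$. (For every $\varepsilon\in(0,1)$ the lazy Metropolis–Hastings matrix, $W_{i,j}=\frac{1-\varepsilon}{d_i}\min\bigl(1,\frac{w_jd_i}{w_id_j}\bigr)$ on edges, with $d_i$ the degree of $i$, is of this kind.) Given a step size $\alpha>0$ and matrices $(W_\lambda,G_\lambda)$, weighted decentralized gradient tracking starts from $\theta_i^{(0)}=\theta^{(0)}$ for all $i$ and $Y^{(0)}=G_\lambda g^{(0)}$, and iterates $$\Theta^{(t+1)}=W_\lambda(\Theta^{(t)}-\alpha Y^{(t)}),\qquad Y^{(t+1)}=W_\lambda Y^{(t)}+G_\lambda(g^{(t+1)}-g^{(t)}),$$ where $\Theta^{(t)},Y^{(t)},g^{(t)}\in\mathbb R^{n\times d}$, the rows of $\Theta^{(t)}$ are $\theta_i^{(t)}$, and those of $g^{(t)}$ are $\nabla f_i(\theta_i^{(t)};\xi_i^{(t)})$. **Notation.** $J=\frac{\mathbf 1\mathbf 1^\top}{n}$, $\Lambda=\frac{\mathbf 1\lambda^\top}{n}$,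 $D_\lambda=\mathrm{diag}(\lambda_1,\dots,\lambda_n)$, $\lambda_{\max}=\max_i\lambda_i$, $\lambda_{\min}=\min_i\lambda_i$, $\kappa_\lambda=\lambda_{\max}/\lambda_{\min}$, $c_\lambda=\frac1{n^2}\sum_i\lambda_i^2$, $A(\rho)=\frac{1+\rho^2}{(1-\rho^2)^3}$, $B(\rho)=\frac{2(1+3\rho^4)}{(1-\rho^2)^3(1-\rho)}$. For $M\in\{J,\Lambda\}$ put $\mathcal E_M=\|(I-M)\Theta^{(0)}\|_{F,\lambda}^2+\alpha^2\|(I-M)Y^{(0)}\|_{F,\lambda}^2$ with $\|X\|_{F,\lambda}^2=\sum_i\lambda_i\|x_i\|^2$ for a matrix $X$ with rows $x_i$. **Theorem.** *(Strategy I.)* Let $(W_\lambda,G_\lambda)=(W^{\mathrm{ds}},D_\lambda)$ with $W^{\mathrm{ds}}$ mixing with weights $\mathbf 1$ (so symmetric and doubly stochastic), let $\rho=\rho_J$ be the spectral radius of $W^{\mathrm{ds}}-J$, and $\bar\theta^{(t)}=\frac1n\sum_i\theta_i^{(t)}$. Then $\rho<1$. If moreover $0<\alpha<\frac1{\lambda_{\max}\beta}\sqrt{\frac1{62B(\rho)}}$,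 then $C_1'=1-60\lambda_{\max}^2\alpha^2\beta^2B(\rho)>0$, $C_2'=1-\frac{2\lambda_{\max}^2\alpha^2\beta^2B(\rho)}{C_1'}>0$, all expectations below are finite, and for every $T\ge1$ $$\begin{aligned}\frac1T\sum_{t=0}^{T-1}\mathbb E\|\nabla F(\bar\theta^{(t)})\|^2\le{}&\frac1{C_2'}\,\frac{2[F(\theta^{(0)})-F(\theta^\star)]}{\alpha T}+\frac1{C_2'}\,\alpha c_\lambda\beta\upsilon^2+\frac{\kappa_\lambda}{C_1'C_2'}\,\frac{6[3(1-\rho^2)^2+\rho^2]\beta^2}{(1-\rho^2)^3nT}\,\mathbb E[\mathcal E_J]\\&+\frac{\lambda_{\max}^2}{C_1'C_2'}\,18\alpha^2\beta^2\upsilon^2\Bigl(A(\rho)+\tfrac32c_\lambda\alpha^2\beta^2B(\rho)\Bigr).\end{aligned}$$ *(Strategy II.)* Let $(W_\lambda,G_\lambda)=(W,I)$ with $W$ mixing with weights $\lambda$, let $\rho=\rho_\Lambda$ be the spectral radius of $W-\Lambda$, and $\bar\theta_\lambda^{(t)}=\frac1n\sum_i\lambda_i\theta_i^{(t)}$. Then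 $\rho<1$. If moreover $0<\alpha<\frac1\beta\sqrt{\frac1{62B(\rho)}}$, then $C_1=1-60\alpha^2\beta^2B(\rho)>0$, $C_2=1-\frac{2\alpha^2\beta^2B(\rho)}{C_1}>0$, all expectations below are finite, and for every $T\ge1$ $$\begin{aligned}\frac1T\sum_{t=0}^{T-1}\mathbb E\|\nabla F(\bar\theta_\lambda^{(t)})\|^2\le{}&\frac1{C_2}\,\frac{2[F(\theta^{(0)})-F(\theta^\star)]}{\alpha T}+\frac1{C_2}\,\alpha c_\lambda\beta\upsilon^2+\frac1{C_1C_2}\,\frac{6[3(1-\rho^2)^2+\rho^2]\beta^2}{(1-\rho^2)^3nT}\,\mathbb E[\mathcal E_\Lambda]\\&+\frac1{C_1C_2}\,18\alpha^2\beta^2\upsilon^2\Bigl(A(\rho)+\tfrac32c_\lambda\alpha^2\beta^2B(\rho)\Bigr).\end{aligned}$$ Thus the Strategy I bound carries the extra factors $\kappa_\lambda$ and $\lambda_{\max}^2$. -/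

import Mathlib

open MeasureTheory ProbabilityTheory

namespace WeightedGT

noncomputable section

/-- The parameter space `ℝ^d` with its Euclidean norm. -/
abbrev Param (d : ℕ) : Type := EuclideanSpace ℝ (Fin d)

/-! ### Weights, weighted norm, matrices acting on stacked vectors -/

/-- `λ_max`. -/
def lamMax {n : ℕ} (lam : Fin n → ℝ) : ℝ := ⨆ i, lam i

/-- `λ_min`. -/
def lamMin {n : ℕ} (lam : Fin n → ℝ) : ℝ := ⨅ i, lam i

/-- `κ_λ = λ_max / λ_min`, the condition number of `D_λ`. -/
def kappa {n : ℕ} (lam : Fin n → ℝ) : ℝ := lamMax lam / lamMin lam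

/-- `c_λ = n⁻² ∑ λ_i²`. -/
def cLam {n : ℕ} (lam : Fin n → ℝ) : ℝ := (1 / (n : ℝ) ^ 2) * ∑ i, lam i ^ 2

/-- The squared weighted Frobenius norm `∑ w_i ‖x_i‖²`; the rows `x_i` are vectors of `ℝ^d`. -/
def wFrobSq {ι : Type*} [Fintype ι] {d : ℕ} (w : ι → ℝ) (X : ι → Param d) : ℝ :=
  ∑ i, w i * ‖X i‖ ^ 2

/-- The product `M X` of an `n × n` matrix with the `n × d` matrix whose rows are the `X i`. -/
def act {n d : ℕ} (M : Matrix (Fin n) (Fin n) ℝ) (X : Fin n → Param d) : Fin n → Param d :=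
  fun i => ∑ j, M i j • X j

/-- `J = 1 1ᵀ / n`. -/
def avgMat (n : ℕ) : Matrix (Fin n) (Fin n) ℝ := Matrix.of fun _ _ => 1 / (n : ℝ)

/-- `Λ = 1 λᵀ / n`. -/
def lamMat {n : ℕ} (lam : Fin n → ℝ) : Matrix (Fin n) (Fin n) ℝ :=
  Matrix.of fun _ j => lam j / (n : ℝ)

/-- The spectral radius of a real matrix: the largest modulus of its complex eigenvalues. -/
def specRad {n : ℕ} (M : Matrix (Fin n) (Fin n) ℝ) : ℝ :=
  (spectralRadius ℂ (M.map (algebraMap ℝ ℂ))).toReal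

/-! ### Mixing matrices over a communication graph -/

/-- `W` is a row-stochastic matrix with positive diagonal, whose positive off-diagonal entries are
exactly those on the edges of `G`, and which is reversible with respect to the weights `w`. For
`w = 1` these are symmetric doubly stochastic matrices. -/
structure IsMixing {n : ℕ} (G : SimpleGraph (Fin n)) (w : Fin n → ℝ)
    (W : Matrix (Fin n) (Fin n) ℝ) : Prop where
  nonneg : ∀ i j, 0 ≤ W i j
  row_sum : ∀ i, ∑ j, W i j = 1
  detailed_balance : ∀ i j, w i * W i j = w j * W j i
  diag_pos : ∀ i, 0 < W i i
  pos_iff_adj : ∀ i j, i ≠ j → (0 < W i j ↔ G.Adj i j)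

open Classical in
/-- The off-diagonal entries of the lazy Metropolis–Hastings matrix with laziness `ε`. -/
def metropolisOff {n : ℕ} (G : SimpleGraph (Fin n)) (w : Fin n → ℝ) (ε : ℝ) (i j : Fin n) : ℝ :=
  if G.Adj i j then
    (1 - ε) / (G.degree i : ℝ) * min 1 ((w j * G.degree i) / (w i * G.degree j))
  else 0

/-- The lazy Metropolis–Hastings matrix of the graph `G` with weights `w` and laziness `ε`. -/
def metropolis {n : ℕ} (G : SimpleGraph (Fin n)) (w : Fin n → ℝ) (ε : ℝ) :
    Matrix (Fin n) (Fin n) ℝ :=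
  Matrix.of fun i j =>
    if i = j then 1 - ∑ k, metropolisOff G w ε i k else metropolisOff G w ε i j

/-- The Metropolis–Hastings construction gives a mixing matrix in the above sense. -/
theorem metropolis_isMixing {n : ℕ} (G : SimpleGraph (Fin n)) (w : Fin n → ℝ)
    (hw : ∀ i, 0 < w i) (ε : ℝ) (hε0 : 0 < ε) (hε1 : ε < 1) :
    IsMixing G w (metropolis G w ε) := by
  classical
  have hdeg : ∀ i j, G.Adj i j → (0 : ℝ) < G.degree i := by
    intro i j h
    exact_mod_cast (G.degree_pos_iff_exists_adj i).2 ⟨j, h⟩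
  have hpos : ∀ i j, G.Adj i j → 0 < metropolisOff G w ε i j := by
    intro i j h
    have h1 := hdeg i j h
    have h2 := hdeg j i h.symm
    have h3 := hw i
    have h4 := hw j
    have h5 : 0 < 1 - ε := by linarith
    rw [metropolisOff, if_pos h]
    have : 0 < min (1 : ℝ) ((w j * G.degree i) / (w i * G.degree j)) :=
      lt_min one_pos (by positivity)
    positivity
  have hnn : ∀ i j, 0 ≤ metropolisOff G w ε i j := by
    intro i j
    by_cases h : G.Adj i j
    · exact (hpos i j h).le
    · simp [metropolisOff, h]
  have hself : ∀ i, metropolisOff G w ε i i = 0 := fun i => by simp [metropolisOff]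
  have hsum : ∀ i, ∑ k, metropolisOff G w ε i k ≤ 1 - ε := by
    intro i
    have h5 : 0 ≤ 1 - ε := by linarith
    calc ∑ k, metropolisOff G w ε i k
        ≤ ∑ k, (if G.Adj i k then (1 - ε) / (G.degree i : ℝ) else 0) := by
          refine Finset.sum_le_sum fun k _ => ?_
          by_cases h : G.Adj i k
          · simp only [metropolisOff, if_pos h]
            exact mul_le_of_le_one_right (by positivity) (min_le_left _ _)
          · simp [metropolisOff, h]
      _ = (G.degree i : ℝ) * ((1 - ε) / (G.degree i : ℝ)) := by
          rw [← Finset.sum_filter, Finset.sum_const, nsmul_eq_mul]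
          congr 2
          rw [← G.card_neighborFinset_eq_degree, G.neighborFinset_eq_filter]
      _ ≤ 1 - ε := by
          by_cases h : (G.degree i : ℝ) = 0
          · rw [h]; simpa using h5
          · rw [mul_div_cancel₀ _ h]
  have hdiag : ∀ i, 0 < metropolis G w ε i i := by
    intro i
    have := hsum i
    simp only [metropolis, Matrix.of_apply, if_true]
    linarith
  have hoff : ∀ i j, i ≠ j → metropolis G w ε i j = metropolisOff G w ε i j := by
    intro i j h
    simp [metropolis, h]
  refine ⟨?_, ?_, ?_, hdiag, ?_⟩
  · intro i j
    by_cases h : i = j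
    · subst h; exact (hdiag i).le
    · rw [hoff i j h]; exact hnn i j
  · intro i
    have h1 : ∀ j, metropolis G w ε i j = metropolisOff G w ε i j +
        (if i = j then 1 - ∑ k, metropolisOff G w ε i k else 0) := by
      intro j
      by_cases h : i = j
      · subst h; simp [metropolis, hself]
      · simp [metropolis, h]
    simp only [h1, Finset.sum_add_distrib, Finset.sum_ite_eq, Finset.mem_univ, if_true]
    ring
  · intro i j
    by_cases h : i = j
    · subst h; rfl
    · rw [hoff i j h, hoff j i (Ne.symm h)]
      by_cases ha : G.Adj i j
      · have h1 := hdeg i j ha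
        have h2 := hdeg j i ha.symm
        have h3 := hw i
        have h4 := hw j
        simp only [metropolisOff, if_pos ha, if_pos ha.symm]
        rcases le_total (w j * (G.degree i : ℝ)) (w i * G.degree j) with hle | hle
        · rw [min_eq_right ((div_le_one (by positivity)).2 hle),
            min_eq_left ((one_le_div (by positivity)).2 hle)]
          field_simp
        · rw [min_eq_left ((one_le_div (by positivity)).2 hle),
            min_eq_right ((div_le_one (by positivity)).2 hle)]
          field_simp
      · have hb : ¬ G.Adj j i := fun h => ha h.symm
        simp [metropolisOff, ha, hb]
  · intro i j h
    rw [hoff i j h]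
    refine ⟨fun hp => ?_, hpos i j⟩
    by_contra ha
    simp [metropolisOff, ha] at hp

/-! ### Losses and stochastic gradients -/

/-- The local loss `F_i(θ) = 𝔼_{ξ ∼ D_i} f_i(θ, ξ)`. -/
def localLoss {n d : ℕ} {Ξ : Type*} [MeasurableSpace Ξ] (f : Fin n → Param d → Ξ → ℝ)
    (D : Fin n → Measure Ξ) (i : Fin n) (θ : Param d) : ℝ :=
  ∫ x, f i θ x ∂(D i)

/-- The global loss `F(θ) = (1/n) ∑ λ_i F_i(θ)`. -/
def globalLoss {n d : ℕ} {Ξ : Type*} [MeasurableSpace Ξ] (lam : Fin n → ℝ)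
    (f : Fin n → Param d → Ξ → ℝ) (D : Fin n → Measure Ξ) (θ : Param d) : ℝ :=
  (1 / (n : ℝ)) * ∑ i, lam i * localLoss f D i θ

/-- The sample gradient `∇ f_i(θ; ξ)`, the gradient being taken in `θ`. -/
def sampleGrad {n d : ℕ} {Ξ : Type*} (f : Fin n → Param d → Ξ → ℝ) (i : Fin n)
    (θ : Param d) (x : Ξ) : Param d :=
  gradient (fun θ' => f i θ' x) θ

/-- Each local loss is differentiable and `β`-smooth. -/
structure IsSmooth {n d : ℕ} {Ξ : Type*} [MeasurableSpace Ξ] (f : Fin n → Param d → Ξ → ℝ)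
    (D : Fin n → Measure Ξ) (β : ℝ) : Prop where
  differentiable : ∀ i, Differentiable ℝ (localLoss f D i)
  lipschitz : ∀ i θ₁ θ₂,
    ‖gradient (localLoss f D i) θ₁ - gradient (localLoss f D i) θ₂‖ ≤ β * ‖θ₁ - θ₂‖

/-- The sample losses are integrable and almost surely differentiable at each `θ`, and their
gradients are jointly measurable, unbiased, and of variance at most `υ²`. -/
structure IsOracle {n d : ℕ} {Ξ : Type*} [MeasurableSpace Ξ] (f : Fin n → Param d → Ξ → ℝ)
    (D : Fin n → Measure Ξ) (υ : ℝ) : Prop where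
  integrable_loss : ∀ i θ, Integrable (f i θ) (D i)
  differentiable : ∀ i θ, ∀ᵐ x ∂(D i), DifferentiableAt ℝ (fun θ' => f i θ' x) θ
  measurable_grad : ∀ i, Measurable fun p : Param d × Ξ => sampleGrad f i p.1 p.2
  unbiased : ∀ i θ, ∫ x, sampleGrad f i θ x ∂(D i) = gradient (localLoss f D i) θ
  integrable_sq : ∀ i θ,
    Integrable (fun x => ‖sampleGrad f i θ x - gradient (localLoss f D i) θ‖ ^ 2) (D i)
  variance_le : ∀ i θ,
    ∫ x, ‖sampleGrad f i θ x - gradient (localLoss f D i) θ‖ ^ 2 ∂(D i) ≤ υ ^ 2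

/-- The samples `ξ_i^{(t)} ∼ D_i`, independent over all nodes `i` and iterations `t`. -/
structure IsSampling {n : ℕ} {Ξ Ω : Type*} [MeasurableSpace Ξ] [MeasurableSpace Ω]
    (P : Measure Ω) (D : Fin n → Measure Ξ) (ξ : ℕ → Fin n → Ω → Ξ) : Prop where
  measurable : ∀ t i, Measurable (ξ t i)
  law : ∀ t i, P.map (ξ t i) = D i
  indep : iIndepFun (fun p : ℕ × Fin n => ξ p.1 p.2) P

/-! ### The algorithm -/

/-- The iterates `(Θ^{(t)}, Y^{(t)})` of gradient tracking with system matrices `W` and `Gm`, step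
size `α`, common initial state `θ₀`, and `Y^{(0)} = Gm g^{(0)}`; here `g t i θ` is the
stochastic gradient that node `i` evaluates at `θ` in iteration `t`. -/
def gtIter {n d : ℕ} (W Gm : Matrix (Fin n) (Fin n) ℝ) (α : ℝ)
    (g : ℕ → Fin n → Param d → Param d) (θ₀ : Param d) :
    ℕ → (Fin n → Param d) × (Fin n → Param d)
  | 0 => (fun _ => θ₀, act Gm fun i => g 0 i θ₀)
  | t + 1 =>
    let Θ := (gtIter W Gm α g θ₀ t).1
    let Y := (gtIter W Gm α g θ₀ t).2
    let Θ' := act W (Θ - α • Y)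
    (Θ', act W Y + act Gm fun i => g (t + 1) i (Θ' i) - g t i (Θ i))

/-- The stacked consensus error: `(I - M) Θ` above `α (I - M) Y`. -/
def consensusError {n d : ℕ} (M : Matrix (Fin n) (Fin n) ℝ) (α : ℝ)
    (S : (Fin n → Param d) × (Fin n → Param d)) : Fin n ⊕ Fin n → Param d :=
  Sum.elim (act (1 - M) S.1) (α • act (1 - M) S.2)

/-- The squared norm `‖·‖²_{F,λ}` of a stacked error, each block being weighted by `λ`. -/
def errSq {n d : ℕ} (lam : Fin n → ℝ) (E : Fin n ⊕ Fin n → Param d) : ℝ :=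
  wFrobSq (Sum.elim lam lam) E

/-- The uniform average `θ̄ = (1/n) ∑ θ_i`. -/
def avg {n d : ℕ} (Θ : Fin n → Param d) : Param d := (1 / (n : ℝ)) • ∑ i, Θ i

/-- The weighted average `θ̄_λ = (1/n) ∑ λ_i θ_i`. -/
def wAvg {n d : ℕ} (lam : Fin n → ℝ) (Θ : Fin n → Param d) : Param d :=
  (1 / (n : ℝ)) • ∑ i, lam i • Θ i

/-- Strategy I: `(W_λ, G_λ) = (W^ds, D_λ)`, run on the samples `ξ(ω)`. -/
def iterI {n d : ℕ} {Ξ Ω : Type*} (lam : Fin n → ℝ) (f : Fin n → Param d → Ξ → ℝ)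
    (Wds : Matrix (Fin n) (Fin n) ℝ) (α : ℝ) (ξ : ℕ → Fin n → Ω → Ξ) (θ₀ : Param d)
    (t : ℕ) (ω : Ω) : (Fin n → Param d) × (Fin n → Param d) :=
  gtIter Wds (Matrix.diagonal lam) α (fun s i θ => sampleGrad f i θ (ξ s i ω)) θ₀ t

/-- Strategy II: `(W_λ, G_λ) = (W, I)`, run on the samples `ξ(ω)`. -/
def iterII {n d : ℕ} {Ξ Ω : Type*} (f : Fin n → Param d → Ξ → ℝ)
    (W : Matrix (Fin n) (Fin n) ℝ) (α : ℝ) (ξ : ℕ → Fin n → Ω → Ξ) (θ₀ : Param d)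
    (t : ℕ) (ω : Ω) : (Fin n → Param d) × (Fin n → Param d) :=
  gtIter W 1 α (fun s i θ => sampleGrad f i θ (ξ s i ω)) θ₀ t

/-! ### Constants of the rates -/

/-- `A(ρ) = (1 + ρ²) / (1 - ρ²)³`. -/
def constA (ρ : ℝ) : ℝ := (1 + ρ ^ 2) / (1 - ρ ^ 2) ^ 3

/-- `B(ρ) = 2 (1 + 3ρ⁴) / ((1 - ρ²)³ (1 - ρ))`. -/
def constB (ρ : ℝ) : ℝ := 2 * (1 + 3 * ρ ^ 4) / ((1 - ρ ^ 2) ^ 3 * (1 - ρ))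

/-- `C₁' = 1 - 60 λ_max² α² β² B(ρ)`. -/
def constC1' (lmax α β ρ : ℝ) : ℝ := 1 - 60 * lmax ^ 2 * α ^ 2 * β ^ 2 * constB ρ

/-- `C₂' = 1 - 2 λ_max² α² β² B(ρ) / C₁'`. -/
def constC2' (lmax α β ρ : ℝ) : ℝ :=
  1 - 2 * lmax ^ 2 * α ^ 2 * β ^ 2 * constB ρ / constC1' lmax α β ρ

/-- `C₁ = 1 - 60 α² β² B(ρ)`. -/
def constC1 (α β ρ : ℝ) : ℝ := 1 - 60 * α ^ 2 * β ^ 2 * constB ρ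

/-- `C₂ = 1 - 2 α² β² B(ρ) / C₁`. -/
def constC2 (α β ρ : ℝ) : ℝ := 1 - 2 * α ^ 2 * β ^ 2 * constB ρ / constC1 α β ρ

end

end WeightedGT

open MeasureTheory ProbabilityTheory

namespace WeightedGT

noncomputable section

section

/-! ### Spectral radius of matrices that are reversible with respect to weights -/

/-! Both strategies are instances of one scheme: mix with weights `w` and scale gradients by `m`,
where `w i * m i = lam i`. Strategy I is `w = 1`, `m = lam`; Strategy II is `w = lam`, `m = 1`. The
bound `m i ≤ L` gives `L = lamMax lam` in the first case and `L = 1` in the second. The common rate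
is `gradient_tracking_rate`.

Conjugation by `√w` makes `W - lamMat w` symmetric, so it contracts the weighted norm by its
spectral radius ρ, and ρ < 1 since the graph is connected and the diagonal positive
(`IsMixing.specRad_lt_one`). The consensus errors `x` of the parameters and `y` of the trackers
(scaled by α) then form a linear system driven by gradient differences, whose solution has kernel `j
• K ^ j` (`consensus_formula`). Gradient noise is uncorrelated in time, so only the ℓ² norm of `j ρ
^ j` matters for it, which produces `constA`. The change of the true gradients has no such structure
and costs the ℓ¹ norm, whose square is at most `constB` (`consensus_bound`).

That change is itself controlled by the consensus errors and by the averaged gradient step, so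
`sum_errΘ_sq_le` bounds the accumulated error by a small multiple of itself, plus a multiple of the
averaged true gradients, plus noise and initial terms. The averaged iterate performs an inexact
stochastic gradient step, and the descent lemma (`sum_gradient_sq_le`) bounds the gradients of the
global loss by the accumulated consensus error, while leaving a spare negative multiple of the
averaged true gradients. For small step sizes that spare term absorbs its counterpart in the
consensus estimate, and `rate_of_estimates` closes the loop. -/

/-- Conjugation of `A` by the diagonal matrix with entries `√w i`. -/
def conjSqrt {n : ℕ} (w : Fin n → ℝ) (A : Matrix (Fin n) (Fin n) ℝ) : Matrix (Fin n) (Fin n) ℝ :=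
  Matrix.of fun i j => √(w i) * A i j / √(w j)

/-- Conjugation by an invertible diagonal matrix leaves the spectrum unchanged. -/
lemma specRad_conjSqrt {n : ℕ} {w : Fin n → ℝ} (hw : ∀ i, 0 < w i)
    (A : Matrix (Fin n) (Fin n) ℝ) : specRad (conjSqrt w A) = specRad A := by
  have hr : ∀ i, (√(w i) : ℂ) ≠ 0 := fun i => by
    exact_mod_cast (Real.sqrt_pos.2 (hw i)).ne'
  let u : (Matrix (Fin n) (Fin n) ℂ)ˣ :=
    ⟨Matrix.diagonal fun i => (√(w i) : ℂ), Matrix.diagonal fun i => (√(w i) : ℂ)⁻¹,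
      by simp [Matrix.diagonal_mul_diagonal, hr], by simp [Matrix.diagonal_mul_diagonal, hr]⟩
  have h : (conjSqrt w A).map (algebraMap ℝ ℂ)
      = (u : Matrix (Fin n) (Fin n) ℂ) * A.map (algebraMap ℝ ℂ) *
        ((u⁻¹ : (Matrix (Fin n) (Fin n) ℂ)ˣ) : Matrix (Fin n) (Fin n) ℂ) := by
    ext i j
    change _ = (Matrix.diagonal (fun i => (√(w i) : ℂ)) * A.map (algebraMap ℝ ℂ) *
      Matrix.diagonal fun i => (√(w i) : ℂ)⁻¹) i j
    simp [conjSqrt, Matrix.mul_diagonal, Matrix.diagonal_mul, div_eq_mul_inv]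
  simp only [specRad, spectralRadius, h, spectrum.units_conjugate]

/-- Detailed balance says that `A` is self-adjoint for the `w`-weighted inner product; conjugation
by `√w` turns this product into the standard one. -/
lemma conjSqrt_isSymm {n : ℕ} {w : Fin n → ℝ} (hw : ∀ i, 0 < w i)
    {A : Matrix (Fin n) (Fin n) ℝ} (hA : ∀ i j, w i * A i j = w j * A j i) :
    (conjSqrt w A).IsSymm := by
  ext i j
  have hi := Real.sqrt_pos.2 (hw i)
  have hj := Real.sqrt_pos.2 (hw j)
  simp only [conjSqrt, Matrix.transpose_apply, Matrix.of_apply]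
  rw [div_eq_div_iff hi.ne' hj.ne']
  have := hA j i
  rw [← Real.mul_self_sqrt (hw i).le, ← Real.mul_self_sqrt (hw j).le] at this
  linarith

lemma specRad_nonneg {n : ℕ} (A : Matrix (Fin n) (Fin n) ℝ) : 0 ≤ specRad A :=
  ENNReal.toReal_nonneg

open scoped Matrix.Norms.L2Operator in
/-- A symmetric matrix contracts Euclidean norms by its spectral radius. -/
lemma sum_mulVec_sq_le {n : ℕ} {S : Matrix (Fin n) (Fin n) ℝ} (hS : S.IsSymm) (x : Fin n → ℝ) :
    ∑ i, (∑ j, S i j * x j) ^ 2 ≤ specRad S ^ 2 * ∑ j, x j ^ 2 := by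
  have hsa : IsSelfAdjoint (S.map (algebraMap ℝ ℂ)) := by
    rw [isSelfAdjoint_iff]
    ext i j
    simp [Matrix.star_apply, hS.apply i j]
  -- For a self-adjoint complex matrix the operator norm equals the spectral radius; hence the
  -- passage to ℂ.
  have hnorm : ‖S.map (algebraMap ℝ ℂ)‖ = specRad S := by
    rw [specRad, hsa.spectralRadius_eq_nnnorm]; simp
  have h := Matrix.l2_opNorm_mulVec (S.map (algebraMap ℝ ℂ))
    (WithLp.toLp 2 fun j => (x j : ℂ))
  rw [hnorm] at h
  have h2 := pow_le_pow_left₀ (norm_nonneg _) h 2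
  rw [mul_pow, EuclideanSpace.norm_sq_eq, EuclideanSpace.norm_sq_eq] at h2
  have h3 : ∀ i, ‖(S.map (algebraMap ℝ ℂ)).mulVec (fun j => (x j : ℂ)) i‖ ^ 2
      = (∑ j, S i j * x j) ^ 2 := fun i => by
    rw [← sq_abs (∑ j, S i j * x j), ← Real.norm_eq_abs, ← Complex.norm_real]
    simp [Matrix.mulVec, dotProduct]
  calc _ = _ := (Finset.sum_congr rfl fun i _ => h3 i).symm
    _ ≤ _ := h2
    _ = _ := by simp

lemma exists_eigenvector_norm_eq_specRad {n : ℕ} [NeZero n] (A : Matrix (Fin n) (Fin n) ℝ) :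
    ∃ (μ : ℂ) (v : Fin n → ℂ), v ≠ 0 ∧ (∀ i, ∑ j, (A i j : ℂ) * v j = μ * v i) ∧
      ‖μ‖ = specRad A := by
  have hne : (spectrum ℂ (A.map (algebraMap ℝ ℂ))).Nonempty := by
    open scoped Matrix.Norms.L2Operator in
    exact spectrum.nonempty _
  obtain ⟨μ, hμ, hμ'⟩ : ∃ μ ∈ spectrum ℂ (A.map (algebraMap ℝ ℂ)),
      (‖μ‖₊ : ENNReal) = spectralRadius ℂ (A.map (algebraMap ℝ ℂ)) := by
    open scoped Matrix.Norms.L2Operator in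
    exact spectrum.exists_nnnorm_eq_spectralRadius_of_nonempty hne
  have hs := hμ
  rw [← Matrix.spectrum_toLin', ← Module.End.hasEigenvalue_iff_mem_spectrum] at hs
  obtain ⟨v, hv⟩ := hs.exists_hasEigenvector
  refine ⟨μ, v, hv.2, fun i => ?_, ?_⟩
  · have := congrFun hv.apply_eq_smul i
    simpa [Matrix.mulVec, dotProduct] using this
  · rw [specRad, ← hμ']; simp

/-! ### Spectral gap of mixing matrices -/

variable {n : ℕ} {G : SimpleGraph (Fin n)} {w : Fin n → ℝ} {W : Matrix (Fin n) (Fin n) ℝ}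

lemma IsMixing.col_sum (hW : IsMixing G w W) (j : Fin n) : ∑ i, w i * W i j = w j := by
  simp only [hW.detailed_balance _ j, ← Finset.mul_sum, hW.row_sum, mul_one]

/-- A mixing matrix that is norm-increasing on an eigenvector has it constant. -/
lemma IsMixing.eigenvector_const (hW : IsMixing G w W) (hG : G.Connected) (hw : ∀ i, 0 < w i)
    {μ : ℂ} (hμ : 1 ≤ ‖μ‖) {v : Fin n → ℂ} (hv : ∀ i, ∑ j, (W i j : ℂ) * v j = μ * v i)
    (i j : Fin n) : v i = v j := by
  -- A variance identity: by the eigenvector equation, `μ * v i` is the mean of `v` under the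
  -- probability weights `W i ·`.
  have hvar : ∀ i, ∑ j, W i j * ‖v j - μ * v i‖ ^ 2
      = ∑ j, W i j * ‖v j‖ ^ 2 - ‖μ‖ ^ 2 * ‖v i‖ ^ 2 := by
    intro i
    have h1 : ∀ j, W i j * ‖v j - μ * v i‖ ^ 2 = W i j * ‖v j‖ ^ 2
        - 2 * (((W i j : ℂ) * v j) * (starRingEnd ℂ) (μ * v i)).re
        + W i j * ‖μ * v i‖ ^ 2 := by
      intro j
      simp only [← Complex.normSq_eq_norm_sq, Complex.normSq_sub]
      simp [Complex.mul_re, Complex.mul_im]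
      ring
    simp only [h1, Finset.sum_add_distrib, Finset.sum_sub_distrib, ← Finset.sum_mul,
      ← Finset.mul_sum, hW.row_sum, ← Complex.re_sum, hv, Complex.mul_conj, Complex.ofReal_re,
      Complex.normSq_eq_norm_sq, norm_mul]
    ring
  -- Averaged against the stationary weights `w`, the variances add up to `(1 - ‖μ‖²) ∑ w i ‖v i‖²`,
  -- so they all vanish when `1 ≤ ‖μ‖`.
  have hsum : ∑ i, w i * ∑ j, W i j * ‖v j - μ * v i‖ ^ 2 ≤ 0 := by
    simp only [hvar, mul_sub, Finset.sum_sub_distrib]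
    have h2 : ∑ i, w i * ∑ j, W i j * ‖v j‖ ^ 2 = ∑ j, w j * ‖v j‖ ^ 2 := by
      simp only [Finset.mul_sum, ← mul_assoc]
      rw [Finset.sum_comm]
      simp only [← Finset.sum_mul, hW.col_sum]
    rw [h2, sub_nonpos]
    refine Finset.sum_le_sum fun i _ => mul_le_mul_of_nonneg_left ?_ (hw i).le
    have : 1 ≤ ‖μ‖ ^ 2 := one_le_pow₀ hμ
    nlinarith [sq_nonneg ‖v i‖]
  have hin : ∀ i, ∀ j ∈ Finset.univ, 0 ≤ W i j * ‖v j - μ * v i‖ ^ 2 :=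
    fun i j _ => mul_nonneg (hW.nonneg i j) (sq_nonneg _)
  have hout : ∀ i ∈ Finset.univ, 0 ≤ w i * ∑ j, W i j * ‖v j - μ * v i‖ ^ 2 :=
    fun i _ => mul_nonneg (hw i).le (Finset.sum_nonneg (hin i))
  have hzero : ∀ i j, 0 < W i j → v j = μ * v i := by
    intro i j hij
    have h3 := (Finset.sum_eq_zero_iff_of_nonneg hout).1
      (le_antisymm hsum (Finset.sum_nonneg hout)) i (Finset.mem_univ i)
    have h4 := (mul_eq_zero.1 h3).resolve_left (hw i).ne'
    have h5 := (Finset.sum_eq_zero_iff_of_nonneg (hin i)).1 h4 j (Finset.mem_univ j)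
    have h6 := (mul_eq_zero.1 h5).resolve_left hij.ne'
    exact sub_eq_zero.1 (norm_eq_zero.1 (pow_eq_zero_iff two_ne_zero |>.1 h6))
  -- Positivity of the diagonal gives `v i = μ * v i`, which identifies the common value along an
  -- edge and excludes eigenvalues such as -1.
  have hadj : ∀ i j, G.Adj i j → v i = v j := fun i j h => by
    rw [hzero i i (hW.diag_pos i), hzero i j ((hW.pos_iff_adj i j h.ne).2 h)]
  obtain ⟨p⟩ := hG.preconnected i j
  induction p with
  | nil => rfl
  | cons h _ ih => exact (hadj _ _ h).trans ih

/-- The weighted averaging matrix absorbs a mixing matrix from the right. -/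
lemma IsMixing.lamMat_mul (hW : IsMixing G w W) : lamMat w * W = lamMat w := by
  ext i j
  simp only [lamMat, Matrix.mul_apply, Matrix.of_apply, div_mul_eq_mul_div, ← Finset.sum_div,
    hW.col_sum]

lemma IsMixing.mul_lamMat (hW : IsMixing G w W) : W * lamMat w = lamMat w := by
  ext i j
  simp only [lamMat, Matrix.mul_apply, Matrix.of_apply, ← Finset.sum_mul, hW.row_sum, one_mul]

lemma lamMat_mul_lamMat [NeZero n] (hsum : ∑ i, w i = n) : lamMat w * lamMat w = lamMat w := by
  have hn : (n : ℝ) ≠ 0 := NeZero.ne _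
  ext i j
  simp only [lamMat, Matrix.mul_apply, Matrix.of_apply, ← Finset.sum_mul, ← Finset.sum_div, hsum,
    div_self hn, one_mul]

/-- Suppose `v` is an eigenvector with `1 ≤ ‖μ‖`. Since `w` annihilates `W - lamMat w` from the
left, `v` has `w`-mean zero and is an eigenvector of `W` itself; it is then constant by
`IsMixing.eigenvector_const`, hence zero. -/
lemma IsMixing.specRad_lt_one [NeZero n] (hW : IsMixing G w W) (hG : G.Connected)
    (hw : ∀ i, 0 < w i) (hsum : ∑ i, w i = n) : specRad (W - lamMat w) < 1 := by
  have hn : (n : ℂ) ≠ 0 := NeZero.ne _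
  have hsumC : ∑ i, (w i : ℂ) = n := by exact_mod_cast hsum
  have hcolC : ∀ j, ∑ i, (w i : ℂ) * W i j = w j := fun j => by exact_mod_cast hW.col_sum j
  obtain ⟨μ, v, hv0, hv, hμ⟩ := exists_eigenvector_norm_eq_specRad (W - lamMat w)
  rw [← hμ]
  by_contra! hlt
  have hμ0 : μ ≠ 0 := by rintro rfl; simp at hlt; linarith
  have hv' : ∀ i, ∑ j, (W i j : ℂ) * v j - (∑ j, (w j : ℂ) * v j) / n = μ * v i := by
    intro i
    rw [← hv i, Finset.sum_div, ← Finset.sum_sub_distrib]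
    refine Finset.sum_congr rfl fun j _ => ?_
    simp [lamMat]; ring
  have hm : ∑ j, (w j : ℂ) * v j = 0 := by
    have h1 : ∑ i, (w i : ℂ) * (μ * v i) = 0 := by
      simp only [← hv', mul_sub, Finset.sum_sub_distrib, ← Finset.sum_mul, hsumC,
        Finset.mul_sum, ← mul_assoc]
      rw [Finset.sum_comm]
      simp only [← Finset.sum_mul, hcolC]
      field_simp
      ring
    simp only [mul_left_comm _ μ, ← Finset.mul_sum] at h1
    exact (mul_eq_zero.1 h1).resolve_left hμ0
  have hconst := hW.eigenvector_const hG hw hlt (v := v) fun i => by simpa [hm] using hv' i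
  refine hv0 (funext fun i => ?_)
  simp only [fun j => hconst j i, ← Finset.sum_mul, hsumC] at hm
  exact (mul_eq_zero.1 hm).resolve_left hn

end

section

/-! ### Arithmetic–geometric sums -/

/-- The partial sum is the full series minus its tail, both in closed form, and the tail is
nonnegative. -/
lemma sum_mul_pow_le {r : ℝ} (h0 : 0 ≤ r) (h1 : r < 1) (N : ℕ) :
    ∑ j ∈ Finset.range N, (j : ℝ) * r ^ j ≤ r / (1 - r) ^ 2 := by
  have h : 0 < 1 - r := by linarith
  have key : ∑ j ∈ Finset.range N, (j : ℝ) * r ^ j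
      = r / (1 - r) ^ 2 - r ^ N * (N / (1 - r) + r / (1 - r) ^ 2) := by
    induction N with
    | zero => simp
    | succ N ih => rw [Finset.sum_range_succ, ih]; push_cast; field_simp; ring
  rw [key]
  have : 0 ≤ r ^ N * (N / (1 - r) + r / (1 - r) ^ 2) := by positivity
  linarith

lemma sum_sq_mul_pow_le {x : ℝ} (h0 : 0 ≤ x) (h1 : x < 1) (N : ℕ) :
    ∑ j ∈ Finset.range N, (j : ℝ) ^ 2 * x ^ j ≤ x * (1 + x) / (1 - x) ^ 3 := by
  have h : 0 < 1 - x := by linarith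
  have key : ∑ j ∈ Finset.range N, (j : ℝ) ^ 2 * x ^ j
      = x * (1 + x) / (1 - x) ^ 3 - x ^ N * (N ^ 2 / (1 - x) + 2 * N * x / (1 - x) ^ 2
        + x * (1 + x) / (1 - x) ^ 3) := by
    induction N with
    | zero => simp
    | succ N ih => rw [Finset.sum_range_succ, ih]; push_cast; field_simp; ring
  rw [key]
  have : 0 ≤ x ^ N * (N ^ 2 / (1 - x) + 2 * N * x / (1 - x) ^ 2
        + x * (1 + x) / (1 - x) ^ 3) := by positivity
  linarith

lemma sum_mul_pow_sq_le {ρ : ℝ} (h0 : 0 ≤ ρ) (h1 : ρ < 1) (N : ℕ) :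
    ∑ j ∈ Finset.range N, ((j : ℝ) * ρ ^ j) ^ 2 ≤ ρ ^ 2 * constA ρ := by
  have h := sum_sq_mul_pow_le (sq_nonneg ρ) (by nlinarith : ρ ^ 2 < 1) N
  simp only [mul_pow, ← pow_mul, mul_comm _ 2] at h ⊢
  rw [constA, ← mul_div_assoc]
  exact h

/-- Young's inequality for causal convolutions. -/
lemma sum_sq_conv_le {a q : ℕ → ℝ} (ha : ∀ j, 0 ≤ a j) {R : ℝ}
    (hR : ∀ N, ∑ j ∈ Finset.range N, a j ≤ R) (N : ℕ) :
    ∑ t ∈ Finset.range (N + 1), (∑ k ∈ Finset.range t, a (t - 1 - k) * q k) ^ 2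
      ≤ R ^ 2 * ∑ k ∈ Finset.range N, q k ^ 2 := by
  have hR0 : 0 ≤ R := by simpa using hR 0
  -- Cauchy–Schwarz with weights `a`; one factor is at most `R`.
  have h1 : ∀ t, (∑ k ∈ Finset.range t, a (t - 1 - k) * q k) ^ 2
      ≤ R * ∑ k ∈ Finset.range t, a (t - 1 - k) * q k ^ 2 := by
    intro t
    refine (Finset.sum_sq_le_sum_mul_sum_of_sq_le_mul _ (f := fun k => a (t - 1 - k))
      (g := fun k => a (t - 1 - k) * q k ^ 2) (fun k _ => ha _)
      (fun k _ => mul_nonneg (ha _) (sq_nonneg _)) (fun k _ => le_of_eq (by ring))).trans ?_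
    refine mul_le_mul_of_nonneg_right ?_
      (Finset.sum_nonneg fun k _ => mul_nonneg (ha _) (sq_nonneg _))
    rw [Finset.sum_range_reflect]
    exact hR t
  calc _ ≤ ∑ t ∈ Finset.range (N + 1),
        R * ∑ k ∈ Finset.range t, a (t - 1 - k) * q k ^ 2 := Finset.sum_le_sum fun t _ => h1 t
    -- The term `t = 0` is an empty sum; removing it leaves a triangular double sum whose order can
    -- be exchanged.
    _ = R * ∑ m ∈ Finset.range N, ∑ k ∈ Finset.range (N - m), a k * q m ^ 2 := by
        rw [← Finset.mul_sum, Finset.sum_range_succ',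
          ← Finset.sum_range_diag_flip N fun m k => a k * q m ^ 2]
        simp
    _ ≤ R * ∑ m ∈ Finset.range N, R * q m ^ 2 := by
        refine mul_le_mul_of_nonneg_left (Finset.sum_le_sum fun m _ => ?_) hR0
        rw [← Finset.sum_mul]
        exact mul_le_mul_of_nonneg_right (hR _) (sq_nonneg _)
    _ = _ := by rw [← Finset.mul_sum]; ring

/-! ### Consensus dynamics in an inner product space -/

variable {H : Type*} [NormedAddCommGroup H] [InnerProductSpace ℝ H]

/-- The response `j • K ^ j` of the consensus error after `j + 1` steps to a unit input. -/
def resp (K : H →L[ℝ] H) (j : ℕ) : H →L[ℝ] H := (j : ℝ) • K ^ j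

lemma norm_resp_apply_le {K : H →L[ℝ] H} {ρ : ℝ} (hK : ∀ v, ‖K v‖ ≤ ρ * ‖v‖) (hρ : 0 ≤ ρ)
    (j : ℕ) (v : H) : ‖resp K j v‖ ≤ j * ρ ^ j * ‖v‖ := by
  have h : ‖(K ^ j) v‖ ≤ ρ ^ j * ‖v‖ := by
    induction j with
    | zero => simp
    | succ j ih =>
      rw [pow_succ', mul_apply_eq_comp, pow_succ', mul_assoc]
      exact (hK _).trans (mul_le_mul_of_nonneg_left ih hρ)
  rw [resp, smul_apply, norm_smul, mul_assoc]
  simpa using mul_le_mul_of_nonneg_left h (Nat.cast_nonneg (α := ℝ) j)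

/-- Since `y` influences `x` only through `K y` and `K` absorbs the projection `Pr`, the projection
disappears. Each input traverses two cascaded copies of the same filter, so its powers of `K`
accumulate with a linear factor. -/
lemma consensus_formula {K Pr : H →L[ℝ] H} (hKP : ∀ v, K (Pr v) = K v) {x y δ : ℕ → H}
    (hx0 : x 0 = 0) (hx : ∀ t, x (t + 1) = K (x t - y t))
    (hy : ∀ t, y (t + 1) = K (y t) + Pr (δ t)) (t : ℕ) :
    x t = -resp K t (y 0) - ∑ k ∈ Finset.range t, resp K (t - 1 - k) (δ k) := by
  have hKy : ∀ t, K (y t) = (K ^ (t + 1)) (y 0)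
      + ∑ k ∈ Finset.range t, (K ^ (t - 1 - k + 1)) (δ k) := by
    intro t
    induction t with
    | zero => simp
    | succ t ih =>
      rw [hy, map_add, hKP, ih, map_add, map_sum, Finset.sum_range_succ, ← add_assoc,
        pow_succ' K (t + 1), mul_apply_eq_comp]
      congr 1
      · congr 1
        refine Finset.sum_congr rfl fun k hk => ?_
        have : t + 1 - 1 - k = t - 1 - k + 1 := by have := Finset.mem_range.1 hk; omega
        rw [this, pow_succ' K (t - 1 - k + 1), mul_apply_eq_comp]
      · simp
  induction t with
  | zero => simp [hx0, resp]
  | succ t ih =>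
    have hres : ∀ (j : ℕ) (v : H), resp K (j + 1) v = K (resp K j v) + (K ^ (j + 1)) v := by
      intro j v
      simp only [resp, smul_apply, map_smul, pow_succ',
        mul_apply_eq_comp]
      push_cast
      rw [add_smul, one_smul]
    -- The most recent input reaches `y` but not yet `x`.
    have hlast : resp K 0 (δ t) = 0 := by simp [resp]
    rw [hx, map_sub, hKy, ih, map_sub, map_neg, map_sum, hres, Finset.sum_range_succ,
      Nat.add_sub_cancel, Nat.sub_self, hlast]
    have : ∑ k ∈ Finset.range t, resp K (t - k) (δ k)
        = ∑ k ∈ Finset.range t, K (resp K (t - 1 - k) (δ k))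
          + ∑ k ∈ Finset.range t, (K ^ (t - 1 - k + 1)) (δ k) := by
      rw [← Finset.sum_add_distrib]
      refine Finset.sum_congr rfl fun k hk => ?_
      have : t - k = t - 1 - k + 1 := by have := Finset.mem_range.1 hk; omega
      rw [this, hres]
    rw [this]
    abel

/-! ### Second moments -/

variable {Ω : Type*} [MeasurableSpace Ω] {P : Measure Ω}

lemma integrable_inner_of_memLp {u v : Ω → H} (hu : MemLp u 2 P) (hv : MemLp v 2 P) :
    Integrable (fun ω => inner ℝ (u ω) (v ω)) P :=
  memLp_one_iff_integrable.1 (hu.of_bilin (fun a b : H => inner ℝ a b) 1 hv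
    (hu.1.inner hv.1) (Filter.Eventually.of_forall fun ω => by
      rw [one_mul, ← NNReal.coe_le_coe]
      exact norm_inner_le_norm (𝕜 := ℝ) (u ω) (v ω)))

lemma integrable_normSq {E : Type*} [NormedAddCommGroup E] {u : Ω → E} (hu : MemLp u 2 P) : Integrable (fun ω => ‖u ω‖ ^ 2) P :=
  hu.integrable_norm_pow two_ne_zero

/-- Pythagoras for pairwise uncorrelated random vectors. -/
lemma integral_normSq_sum_of_orthogonal {ι : Type*} (I : Finset ι) {v : ι → Ω → H}
    (hv : ∀ i ∈ I, MemLp (v i) 2 P)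
    (horth : ∀ i ∈ I, ∀ j ∈ I, i ≠ j → ∫ ω, inner ℝ (v i ω) (v j ω) ∂P = 0) :
    ∫ ω, ‖∑ i ∈ I, v i ω‖ ^ 2 ∂P = ∑ i ∈ I, ∫ ω, ‖v i ω‖ ^ 2 ∂P := by
  simp only [← real_inner_self_eq_norm_sq, sum_inner, inner_sum]
  rw [integral_finsetSum _ fun i hi => integrable_finsetSum _ fun j hj =>
    integrable_inner_of_memLp (hv j hj) (hv i hi)]
  refine Finset.sum_congr rfl fun i hi => ?_
  rw [integral_finsetSum _ fun j hj => integrable_inner_of_memLp (hv j hj) (hv i hi)]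
  exact Finset.sum_eq_single_of_mem i hi fun j hj hij => horth j hj i hi hij

/-- The weights come from treating `u - v` as one of three terms, `(a + c + b)² ≤ 3a² + 3c² + 3b²`,
and then splitting it with a factor 2. -/
lemma norm_sq_four_le {E : Type*} [SeminormedAddCommGroup E] (a c u v : E) :
    ‖-a - (c + u - v)‖ ^ 2 ≤ 3 * ‖a‖ ^ 2 + 3 * ‖c‖ ^ 2 + 6 * ‖u‖ ^ 2 + 6 * ‖v‖ ^ 2 := by
  have h : ‖-a - (c + u - v)‖ ≤ ‖a‖ + ‖c‖ + ‖u‖ + ‖v‖ := by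
    calc ‖-a - (c + u - v)‖ ≤ ‖-a‖ + ‖c + u - v‖ := norm_sub_le _ _
      _ ≤ ‖a‖ + (‖c‖ + ‖u‖ + ‖v‖) := by
        rw [norm_neg]
        gcongr
        exact (norm_sub_le _ _).trans (by gcongr; exact norm_add_le _ _)
      _ = _ := by ring
  have h2 := pow_le_pow_left₀ (norm_nonneg _) h 2
  nlinarith [sq_nonneg (‖a‖ - ‖c‖), sq_nonneg (‖a‖ - ‖u‖ - ‖v‖), sq_nonneg (‖c‖ - ‖u‖ - ‖v‖),
    sq_nonneg (‖u‖ - ‖v‖)]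

/-- Second-moment bound for the consensus error: the noise `s` enters through differences and is
uncorrelated in time, whereas `p` is an arbitrary perturbation. -/
theorem consensus_bound {K Pr : H →L[ℝ] H} {ρ α σ2 : ℝ}
    (hK : ∀ v, ‖K v‖ ≤ ρ * ‖v‖) (hρ : 0 ≤ ρ) (hρ1 : ρ < 1) (hKP : ∀ v, K (Pr v) = K v)
    {x y p s : ℕ → Ω → H} (hx0 : ∀ ω, x 0 ω = 0)
    (hx : ∀ t ω, x (t + 1) ω = K (x t ω - y t ω))
    (hy : ∀ t ω, y (t + 1) ω = K (y t ω) + Pr (α • (p t ω + s (t + 1) ω - s t ω)))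
    (hy0 : MemLp (y 0) 2 P) (hp : ∀ t, MemLp (p t) 2 P) (hs : ∀ t, MemLp (s t) 2 P)
    (hσ : ∀ t, ∫ ω, ‖s t ω‖ ^ 2 ∂P ≤ σ2)
    (horth : ∀ (A B : H →L[ℝ] H) (k l : ℕ), k ≠ l →
      ∫ ω, inner ℝ (A (s k ω)) (B (s l ω)) ∂P = 0) (N : ℕ) :
    ∑ t ∈ Finset.range (N + 1), ∫ ω, ‖x t ω‖ ^ 2 ∂P
      ≤ 3 * (ρ ^ 2 * constA ρ) * ∫ ω, ‖y 0 ω‖ ^ 2 ∂P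
        + 12 * α ^ 2 * (ρ ^ 2 * constA ρ) * σ2 * (N + 1)
        + 3 * α ^ 2 * (ρ / (1 - ρ) ^ 2) ^ 2 * ∑ k ∈ Finset.range N, ∫ ω, ‖p k ω‖ ^ 2 ∂P := by
  have hσ0 : 0 ≤ σ2 := (integral_nonneg fun ω => sq_nonneg _).trans (hσ 0)
  set Q := resp K with hQ
  have hQn : ∀ j v, ‖Q j v‖ ≤ j * ρ ^ j * ‖v‖ := norm_resp_apply_le hK hρ
  have hQL : ∀ j {v : Ω → H}, MemLp v 2 P → MemLp (fun ω => Q j (v ω)) 2 P :=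
    fun j v hv => (Q j).comp_memLp' hv
  have hQsq : ∀ j {v : Ω → H}, MemLp v 2 P →
      ∫ ω, ‖Q j (v ω)‖ ^ 2 ∂P ≤ (j * ρ ^ j) ^ 2 * ∫ ω, ‖v ω‖ ^ 2 ∂P := by
    intro j v hv
    rw [← integral_const_mul]
    refine integral_mono (integrable_normSq (hQL j hv)) ((integrable_normSq hv).const_mul _)
      fun ω => ?_
    simp only [← mul_pow]
    exact pow_le_pow_left₀ (norm_nonneg _) (hQn j _) 2
  have hsumL : ∀ (t : ℕ) {v : ℕ → Ω → H}, (∀ k, MemLp (v k) 2 P) →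
      MemLp (fun ω => ∑ k ∈ Finset.range t, Q (t - 1 - k) (v k ω)) 2 P :=
    fun t v hv => memLp_finsetSum _ fun k _ => hQL _ (hv k)
  -- The sums over `s (k + 1)` and over `s k` share noise vectors, so they are separated first;
  -- within each of them Pythagoras applies. The reindexing `e` treats the shifted and the unshifted
  -- sum together.
  have hnoise : ∀ (t : ℕ) (e : ℕ → ℕ), Function.Injective e →
      ∫ ω, ‖∑ k ∈ Finset.range t, Q (t - 1 - k) (s (e k) ω)‖ ^ 2 ∂P
        ≤ ρ ^ 2 * constA ρ * σ2 := by
    intro t e he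
    rw [integral_normSq_sum_of_orthogonal _ (fun k _ => hQL _ (hs (e k)))
      (fun k _ l _ hkl => horth _ _ _ _ (he.ne hkl))]
    calc _ ≤ ∑ k ∈ Finset.range t, (((t - 1 - k : ℕ) : ℝ) * ρ ^ (t - 1 - k)) ^ 2 * σ2 :=
          Finset.sum_le_sum fun k _ => (hQsq _ (hs _)).trans
            (mul_le_mul_of_nonneg_left (hσ _) (sq_nonneg _))
      _ ≤ _ := by
          rw [← Finset.sum_mul, Finset.sum_range_reflect fun j => ((j : ℝ) * ρ ^ j) ^ 2]
          exact mul_le_mul_of_nonneg_right (sum_mul_pow_sq_le hρ hρ1 t) hσ0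
  have hpt : ∀ t ω, ‖x t ω‖ ^ 2 ≤ 3 * ‖Q t (y 0 ω)‖ ^ 2
      + 3 * α ^ 2 * ‖∑ k ∈ Finset.range t, Q (t - 1 - k) (p k ω)‖ ^ 2
      + 6 * α ^ 2 * ‖∑ k ∈ Finset.range t, Q (t - 1 - k) (s (k + 1) ω)‖ ^ 2
      + 6 * α ^ 2 * ‖∑ k ∈ Finset.range t, Q (t - 1 - k) (s k ω)‖ ^ 2 := by
    intro t ω
    have h1 := consensus_formula (x := fun t => x t ω) (y := fun t => y t ω) hKP (hx0 ω) (fun t => hx t ω) (fun t => hy t ω) t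
    have h2 := norm_sq_four_le (Q t (y 0 ω))
      (α • ∑ k ∈ Finset.range t, Q (t - 1 - k) (p k ω))
      (α • ∑ k ∈ Finset.range t, Q (t - 1 - k) (s (k + 1) ω))
      (α • ∑ k ∈ Finset.range t, Q (t - 1 - k) (s k ω))
    rw [← smul_add, ← smul_sub, ← Finset.sum_add_distrib, ← Finset.sum_sub_distrib] at h2
    simp only [← map_add, ← map_sub] at h2
    simp only [map_smul, ← Finset.smul_sum] at h1
    rw [h1]
    simp only [norm_smul, mul_pow, Real.norm_eq_abs, sq_abs] at h2
    linarith
  -- The two noise sums contribute `6 + 6 = 12`.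
  have hterm : ∀ t, ∫ ω, ‖x t ω‖ ^ 2 ∂P ≤ 3 * ((t * ρ ^ t) ^ 2 * ∫ ω, ‖y 0 ω‖ ^ 2 ∂P)
      + 3 * α ^ 2 * (∫ ω, (∑ k ∈ Finset.range t,
          (((t - 1 - k : ℕ) : ℝ) * ρ ^ (t - 1 - k)) * ‖p k ω‖) ^ 2 ∂P)
      + 12 * α ^ 2 * (ρ ^ 2 * constA ρ) * σ2 := by
    intro t
    have i1 := (integrable_normSq (hQL t hy0)).const_mul 3
    have i2 := (integrable_normSq (hsumL t hp)).const_mul (3 * α ^ 2)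
    have i3 := (integrable_normSq (hsumL t fun k => hs (k + 1))).const_mul (6 * α ^ 2)
    have i4 := (integrable_normSq (hsumL t hs)).const_mul (6 * α ^ 2)
    have i5 : Integrable (fun ω => (∑ k ∈ Finset.range t,
          (((t - 1 - k : ℕ) : ℝ) * ρ ^ (t - 1 - k)) * ‖p k ω‖) ^ 2) P :=
      (memLp_finsetSum _ fun k _ => (hp k).norm.const_mul _).integrable_sq
    have h1 : ∫ ω, ‖x t ω‖ ^ 2 ∂P ≤ _ :=
      integral_mono_of_nonneg (Filter.Eventually.of_forall fun ω => sq_nonneg _)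
        (((i1.add i2).add i3).add i4) (Filter.Eventually.of_forall (hpt t))
    rw [integral_add' ((i1.add i2).add i3) i4, integral_add' (i1.add i2) i3,
      integral_add' i1 i2] at h1
    simp only [integral_const_mul] at h1
    have h2 := hnoise t _ (add_left_injective 1)
    have h3 := hnoise t _ Function.injective_id
    have h4 := hQsq t hy0
    have h5 : ∫ ω, ‖∑ k ∈ Finset.range t, Q (t - 1 - k) (p k ω)‖ ^ 2 ∂P ≤ _ :=
      integral_mono (integrable_normSq (hsumL t hp)) i5 fun ω =>
        pow_le_pow_left₀ (norm_nonneg _) ((norm_sum_le _ _).trans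
          (Finset.sum_le_sum fun k _ => hQn _ _)) 2
    have hα : 0 ≤ α ^ 2 := sq_nonneg α
    simp only [id] at h3
    nlinarith [mul_le_mul_of_nonneg_left h2 hα, mul_le_mul_of_nonneg_left h3 hα,
      mul_le_mul_of_nonneg_left h5 hα]
  -- Young's inequality is applied pathwise for each ω and then integrated.
  have hconv : ∑ t ∈ Finset.range (N + 1), (∫ ω, (∑ k ∈ Finset.range t,
          (((t - 1 - k : ℕ) : ℝ) * ρ ^ (t - 1 - k)) * ‖p k ω‖) ^ 2 ∂P)
      ≤ (ρ / (1 - ρ) ^ 2) ^ 2 * ∑ k ∈ Finset.range N, ∫ ω, ‖p k ω‖ ^ 2 ∂P := by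
    have i5 : ∀ t : ℕ, Integrable (fun ω => (∑ k ∈ Finset.range t,
          (((t - 1 - k : ℕ) : ℝ) * ρ ^ (t - 1 - k)) * ‖p k ω‖) ^ 2) P := fun t =>
      (memLp_finsetSum _ fun k _ => (hp k).norm.const_mul _).integrable_sq
    rw [← integral_finsetSum _ fun t _ => i5 t,
      ← integral_finsetSum _ fun k _ => integrable_normSq (hp k), ← integral_const_mul]
    refine integral_mono (integrable_finsetSum _ fun t _ => i5 t)
      ((integrable_finsetSum _ fun k _ => integrable_normSq (hp k)).const_mul _) fun ω => ?_
    exact sum_sq_conv_le (a := fun j : ℕ => (j : ℝ) * ρ ^ j) (q := fun k => ‖p k ω‖)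
      (fun j => by positivity) (sum_mul_pow_le hρ hρ1) N
  have hy0n : 0 ≤ ∫ ω, ‖y 0 ω‖ ^ 2 ∂P := integral_nonneg fun ω => sq_nonneg _
  refine (Finset.sum_le_sum fun t _ => hterm t).trans ?_
  rw [Finset.sum_add_distrib, Finset.sum_add_distrib, ← Finset.mul_sum, ← Finset.mul_sum,
    ← Finset.sum_mul, Finset.sum_const, Finset.card_range, nsmul_eq_mul]
  have h6 := mul_le_mul_of_nonneg_right (sum_mul_pow_sq_le hρ hρ1 (N + 1)) hy0n
  have h7 := mul_le_mul_of_nonneg_left hconv (by positivity : 0 ≤ 3 * α ^ 2)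
  push_cast
  linarith

end

section

/-! ### Stochastic gradients along the run of the algorithm -/

variable {n d : ℕ} {Ξ Ω : Type*} [MeasurableSpace Ξ]

/-- The deviation of a sample gradient from the gradient of the local loss. -/
def gradNoise (f : Fin n → Param d → Ξ → ℝ) (D : Fin n → Measure Ξ) (i : Fin n) (θ : Param d)
    (x : Ξ) : Param d :=
  sampleGrad f i θ x - gradient (localLoss f D i) θ

/-- The σ-algebra generated by the samples with indices in `S`. -/
def sampleSigma (ξ : ℕ → Fin n → Ω → Ξ) (S : Set (ℕ × Fin n)) : MeasurableSpace Ω :=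
  ⨆ p ∈ S, MeasurableSpace.comap (ξ p.1 p.2) inferInstance

/-- The index set of the samples drawn before iteration `t`. -/
def before (n t : ℕ) : Set (ℕ × Fin n) := {p | p.1 < t}

lemma before_mono {s t : ℕ} (h : s ≤ t) : before n s ⊆ before n t := fun _ hp => lt_of_lt_of_le hp h

lemma sampleSigma_mono (ξ : ℕ → Fin n → Ω → Ξ) {S T : Set (ℕ × Fin n)} (h : S ⊆ T) :
    sampleSigma ξ S ≤ sampleSigma ξ T := biSup_mono h

lemma measurable_sample (ξ : ℕ → Fin n → Ω → Ξ) {S : Set (ℕ × Fin n)} {t : ℕ} {i : Fin n}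
    (h : (t, i) ∈ S) : Measurable[sampleSigma ξ S] (ξ t i) := by
  rw [measurable_iff_comap_le]
  exact le_biSup (fun p : ℕ × Fin n => MeasurableSpace.comap (ξ p.1 p.2) inferInstance) h

variable {f : Fin n → Param d → Ξ → ℝ} {D : Fin n → Measure Ξ} {ξ : ℕ → Fin n → Ω → Ξ} {β υ : ℝ}

lemma IsSmooth.continuous_gradient (hsm : IsSmooth f D β) (i : Fin n) :
    Continuous (gradient (localLoss f D i)) := by
  refine (LipschitzWith.of_dist_le_mul (K := β.toNNReal) fun x y => ?_).continuous
  rw [dist_eq_norm, dist_eq_norm]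
  exact (hsm.lipschitz i x y).trans
    (mul_le_mul_of_nonneg_right (Real.le_coe_toNNReal β) (norm_nonneg _))

lemma measurable_gradNoise (hsm : IsSmooth f D β) (hor : IsOracle f D υ) (i : Fin n) :
    Measurable fun p : Param d × Ξ => gradNoise f D i p.1 p.2 :=
  (hor.measurable_grad i).sub ((hsm.continuous_gradient i).measurable.comp measurable_fst)

lemma memLp_gradNoise (hsm : IsSmooth f D β) (hor : IsOracle f D υ) (i : Fin n) (θ : Param d) :
    MemLp (gradNoise f D i θ) 2 (D i) :=
  (memLp_two_iff_integrable_sq_norm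
    ((measurable_gradNoise hsm hor i).comp measurable_prodMk_left).aestronglyMeasurable).2
    (hor.integrable_sq i θ)

lemma measurable_gradNoise_comp {mΩ : MeasurableSpace Ω} (hsm : IsSmooth f D β)
    (hor : IsOracle f D υ) (i : Fin n) {θ : Ω → Param d} {X : Ω → Ξ} (hθ : Measurable θ)
    (hX : Measurable X) : Measurable fun ω => gradNoise f D i (θ ω) (X ω) := by
  have h := (measurable_gradNoise hsm hor i).comp (hθ.prodMk hX)
  exact h

/-- Gradient tracking with system matrices `W` and `Gm`, run on the samples `ξ(ω)`. -/
def run (f : Fin n → Param d → Ξ → ℝ) (W Gm : Matrix (Fin n) (Fin n) ℝ) (α : ℝ)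
    (ξ : ℕ → Fin n → Ω → Ξ) (θ₀ : Param d) (t : ℕ) (ω : Ω) :
    (Fin n → Param d) × (Fin n → Param d) :=
  gtIter W Gm α (fun s i θ => sampleGrad f i θ (ξ s i ω)) θ₀ t

variable {W Gm : Matrix (Fin n) (Fin n) ℝ} {α : ℝ} {θ₀ : Param d}

/-- The parameters of iteration `t` are determined by samples strictly before `t`, whereas the
trackers also use the samples of iteration `t`. This offset is what makes the current noise
independent of the point where it is evaluated. -/
lemma measurable_run (hor : IsOracle f D υ) (t : ℕ) :
    (∀ i, Measurable[sampleSigma ξ (before n t)] fun ω => (run f W Gm α ξ θ₀ t ω).1 i) ∧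
    ∀ i, Measurable[sampleSigma ξ (before n (t + 1))] fun ω => (run f W Gm α ξ θ₀ t ω).2 i := by
  have hg : ∀ (s t : ℕ) (θ : Ω → Param d) (i : Fin n), s < t →
      Measurable[sampleSigma ξ (before n t)] θ →
      Measurable[sampleSigma ξ (before n t)] fun ω => sampleGrad f i (θ ω) (ξ s i ω) := by
    intro s t θ i hst hθ
    exact (hor.measurable_grad i).comp (hθ.prodMk (measurable_sample ξ hst))
  induction t with
  | zero =>
    refine ⟨fun i => measurable_const, fun i => ?_⟩
    change Measurable[sampleSigma ξ (before n 1)] fun ω => ∑ j, Gm i j • sampleGrad f j θ₀ (ξ 0 j ω)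
    exact Finset.measurable_fun_sum _ fun j _ =>
      (hg 0 1 _ j one_pos measurable_const).const_smul (Gm i j)
  | succ t ih =>
    obtain ⟨h1, h2⟩ := ih
    have h1' := fun i => (h1 i).mono (sampleSigma_mono ξ (before_mono (n := n) t.le_succ)) le_rfl
    have h3 : ∀ i, Measurable[sampleSigma ξ (before n (t + 1))]
        fun ω => (run f W Gm α ξ θ₀ (t + 1) ω).1 i := by
      intro i
      change Measurable[sampleSigma ξ (before n (t + 1))] fun ω => ∑ j, W i j •
        ((run f W Gm α ξ θ₀ t ω).1 j - α • (run f W Gm α ξ θ₀ t ω).2 j)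
      exact Finset.measurable_fun_sum _ fun j _ =>
        ((h1' j).sub ((h2 j).const_smul α)).const_smul (W i j)
    refine ⟨h3, fun i => ?_⟩
    have hle := sampleSigma_mono ξ (before_mono (n := n) (t + 1).le_succ)
    change Measurable[sampleSigma ξ (before n (t + 1 + 1))] fun ω => ∑ j, W i j • (run f W Gm α ξ θ₀ t ω).2 j +
      ∑ j, Gm i j • (sampleGrad f j ((run f W Gm α ξ θ₀ (t + 1) ω).1 j) (ξ (t + 1) j ω)
        - sampleGrad f j ((run f W Gm α ξ θ₀ t ω).1 j) (ξ t j ω))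
    refine (Finset.measurable_fun_sum _ fun j _ =>
      ((h2 j).mono hle le_rfl).const_smul (W i j)).add
      (Finset.measurable_fun_sum _ fun j _ => ((hg _ _ _ _ ?_ ?_).sub
        (hg _ _ _ _ ?_ ?_)).const_smul (Gm i j))
    · omega
    · exact (h3 j).mono hle le_rfl
    · omega
    · exact (h1' j).mono hle le_rfl

lemma notMem_before (t : ℕ) (i : Fin n) : (t, i) ∉ before n t := fun h => lt_irrefl t h

variable [MeasurableSpace Ω] {P : Measure Ω}

lemma IsSampling.sampleSigma_le (hξ : IsSampling P D ξ) (S : Set (ℕ × Fin n)) :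
    sampleSigma ξ S ≤ ‹MeasurableSpace Ω› :=
  iSup₂_le fun p _ => (hξ.measurable p.1 p.2).comap_le

lemma IsSampling.indepFun (hξ : IsSampling P D ξ) {S : Set (ℕ × Fin n)} {t : ℕ} {i : Fin n}
    (h : (t, i) ∉ S) {E : Type*} [MeasurableSpace E] {Z : Ω → E}
    (hZ : Measurable[sampleSigma ξ S] Z) : IndepFun Z (ξ t i) P := by
  have h1 := indep_iSup_of_disjoint (fun p : ℕ × Fin n => (hξ.measurable p.1 p.2).comap_le)
    hξ.indep (Set.disjoint_singleton_right.2 h)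
  rw [iSup_singleton] at h1
  exact indep_of_indep_of_le_left h1 (measurable_iff_comap_le.1 hZ)

/-- A Lipschitz gradient grows at most linearly, so it preserves square integrability. -/
lemma memLp_comp_gradient [IsFiniteMeasure P] (hsm : IsSmooth f D β) (i : Fin n) {θ : Ω → Param d}
    (hθ : MemLp θ 2 P) : MemLp (fun ω => gradient (localLoss f D i) (θ ω)) 2 P := by
  have h0 : MemLp (fun _ : Ω => ‖gradient (localLoss f D i) 0‖) 2 P := memLp_const _
  refine ((hθ.norm.const_mul β).add h0).mono
    ((hsm.continuous_gradient i).comp_aestronglyMeasurable hθ.1)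
    (Filter.Eventually.of_forall fun ω => ?_)
  have h := hsm.lipschitz i (θ ω) 0
  rw [sub_zero] at h
  refine le_trans ?_ (le_abs_self _)
  have := norm_le_norm_add_norm_sub' (gradient (localLoss f D i) (θ ω))
    (gradient (localLoss f D i) 0)
  simp only [Pi.add_apply]
  linarith

/-- This product law replaces conditional expectations: a fresh sample is integrated out by Fubini,
with everything determined by the other samples held fixed. -/
lemma IsSampling.map_prod [IsFiniteMeasure P] (hξ : IsSampling P D ξ) {S : Set (ℕ × Fin n)} {t : ℕ} {i : Fin n}
    (h : (t, i) ∉ S) {E : Type*} [MeasurableSpace E] {Z : Ω → E}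
    (hZ : Measurable[sampleSigma ξ S] Z) :
    P.map (fun ω => (Z ω, ξ t i ω)) = (P.map Z).prod (D i) := by
  rw [(indepFun_iff_map_prod_eq_prod_map_map
    (hZ.mono (hξ.sampleSigma_le S) le_rfl).aemeasurable
    (hξ.measurable t i).aemeasurable).1 (hξ.indepFun h hZ), hξ.law]

variable [∀ i, IsProbabilityMeasure (D i)]

lemma integral_gradNoise (hsm : IsSmooth f D β) (hor : IsOracle f D υ) (i : Fin n) (θ : Param d) :
    ∫ x, gradNoise f D i θ x ∂(D i) = 0 := by
  have h1 : Integrable (gradNoise f D i θ) (D i) :=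
    (memLp_gradNoise hsm hor i θ).integrable one_le_two
  have h2 : Integrable (sampleGrad f i θ) (D i) := by
    refine (h1.add (integrable_const (gradient (localLoss f D i) θ))).congr
      (Filter.Eventually.of_forall fun x => ?_)
    simp [gradNoise]
  simp only [gradNoise]
  rw [integral_sub h2 (integrable_const _), hor.unbiased]
  simp

variable [IsProbabilityMeasure P]

/-- The variance bound holds at every fixed parameter, hence at an independent random one by
Tonelli. The lower integral is used because integrability along the run is deduced from this bound.
-/
lemma IsSampling.lintegral_gradNoise_sq_le (hξ : IsSampling P D ξ) (hsm : IsSmooth f D β)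
    (hor : IsOracle f D υ) {S : Set (ℕ × Fin n)} {t : ℕ} {i : Fin n} (h : (t, i) ∉ S)
    {θ : Ω → Param d} (hθ : Measurable[sampleSigma ξ S] θ) :
    ∫⁻ ω, ENNReal.ofReal (‖gradNoise f D i (θ ω) (ξ t i ω)‖ ^ 2) ∂P ≤ ENNReal.ofReal (υ ^ 2) := by
  have hθ' : Measurable θ := hθ.mono (hξ.sampleSigma_le S) le_rfl
  have hm : Measurable fun p : Param d × Ξ => ENNReal.ofReal (‖gradNoise f D i p.1 p.2‖ ^ 2) :=
    ((measurable_gradNoise hsm hor i).norm.pow_const 2).ennreal_ofReal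
  have := Measure.isProbabilityMeasure_map (μ := P) hθ'.aemeasurable
  calc ∫⁻ ω, ENNReal.ofReal (‖gradNoise f D i (θ ω) (ξ t i ω)‖ ^ 2) ∂P
      = ∫⁻ p, ENNReal.ofReal (‖gradNoise f D i p.1 p.2‖ ^ 2)
          ∂(P.map fun ω => (θ ω, ξ t i ω)) :=
        (lintegral_map hm (hθ'.prodMk (hξ.measurable t i))).symm
    _ = ∫⁻ z, ∫⁻ x, ENNReal.ofReal (‖gradNoise f D i z x‖ ^ 2) ∂(D i) ∂(P.map θ) := by
        rw [hξ.map_prod h hθ, lintegral_prod _ hm.aemeasurable]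
    _ ≤ ∫⁻ _, ENNReal.ofReal (υ ^ 2) ∂(P.map θ) := by
        refine lintegral_mono fun z => ?_
        rw [← ofReal_integral_eq_lintegral_ofReal
          (integrable_normSq (WeightedGT.memLp_gradNoise hsm hor i z)) (Filter.Eventually.of_forall fun x => sq_nonneg _)]
        exact ENNReal.ofReal_le_ofReal (hor.variance_le i z)
    _ = ENNReal.ofReal (υ ^ 2) := by simp

lemma IsSampling.memLp_gradNoise (hξ : IsSampling P D ξ) (hsm : IsSmooth f D β)
    (hor : IsOracle f D υ) {S : Set (ℕ × Fin n)} {t : ℕ} {i : Fin n} (h : (t, i) ∉ S)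
    {θ : Ω → Param d} (hθ : Measurable[sampleSigma ξ S] θ) :
    MemLp (fun ω => gradNoise f D i (θ ω) (ξ t i ω)) 2 P := by
  have hm : Measurable fun ω => gradNoise f D i (θ ω) (ξ t i ω) :=
    measurable_gradNoise_comp hsm hor i (hθ.mono (hξ.sampleSigma_le S) le_rfl)
      (hξ.measurable t i)
  rw [memLp_two_iff_integrable_sq_norm hm.aestronglyMeasurable]
  refine ⟨(hm.norm.pow_const 2).aestronglyMeasurable, ?_⟩
  rw [hasFiniteIntegral_iff_ofReal (Filter.Eventually.of_forall fun x => sq_nonneg _)]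
  exact (hξ.lintegral_gradNoise_sq_le hsm hor h hθ).trans_lt ENNReal.ofReal_lt_top

lemma IsSampling.integral_gradNoise_sq_le (hξ : IsSampling P D ξ) (hsm : IsSmooth f D β)
    (hor : IsOracle f D υ) {S : Set (ℕ × Fin n)} {t : ℕ} {i : Fin n} (h : (t, i) ∉ S)
    {θ : Ω → Param d} (hθ : Measurable[sampleSigma ξ S] θ) :
    ∫ ω, ‖gradNoise f D i (θ ω) (ξ t i ω)‖ ^ 2 ∂P ≤ υ ^ 2 := by
  have h1 := hξ.lintegral_gradNoise_sq_le hsm hor h hθ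
  rw [← ofReal_integral_eq_lintegral_ofReal
    (integrable_normSq (hξ.memLp_gradNoise hsm hor h hθ))
    (Filter.Eventually.of_forall fun x => sq_nonneg _)] at h1
  exact (ENNReal.ofReal_le_ofReal_iff (sq_nonneg υ)).1 h1

/-- The noise of a sample is uncorrelated with everything that does not depend on that sample. -/
lemma IsSampling.integral_inner_gradNoise (hξ : IsSampling P D ξ) (hsm : IsSmooth f D β)
    (hor : IsOracle f D υ) {S : Set (ℕ × Fin n)} {t : ℕ} {i : Fin n} (h : (t, i) ∉ S)
    {θ b : Ω → Param d} (hθ : Measurable[sampleSigma ξ S] θ) (hb : Measurable[sampleSigma ξ S] b)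
    (hb2 : MemLp b 2 P) :
    ∫ ω, inner ℝ (b ω) (gradNoise f D i (θ ω) (ξ t i ω)) ∂P = 0 := by
  have hZ : Measurable[sampleSigma ξ S] fun ω => (θ ω, b ω) := hθ.prodMk hb
  have hZX : Measurable fun ω => ((θ ω, b ω), ξ t i ω) :=
    (hZ.mono (hξ.sampleSigma_le S) le_rfl).prodMk (hξ.measurable t i)
  have hm : Measurable fun p : (Param d × Param d) × Ξ =>
      inner ℝ p.1.2 (gradNoise f D i p.1.1 p.2) :=
    (measurable_snd.comp measurable_fst).inner (measurable_gradNoise_comp hsm hor i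
      (measurable_fst.comp measurable_fst) measurable_snd)
  have hint := integrable_inner_of_memLp hb2 (hξ.memLp_gradNoise hsm hor h hθ)
  have hint' := (integrable_map_measure hm.aestronglyMeasurable hZX.aemeasurable).2 hint
  rw [hξ.map_prod h hZ] at hint'
  have := Measure.isProbabilityMeasure_map (μ := P)
    (hZ.mono (hξ.sampleSigma_le S) le_rfl).aemeasurable
  calc ∫ ω, inner ℝ (b ω) (gradNoise f D i (θ ω) (ξ t i ω)) ∂P
      = ∫ p, inner ℝ p.1.2 (gradNoise f D i p.1.1 p.2)
          ∂(P.map fun ω => ((θ ω, b ω), ξ t i ω)) :=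
        (integral_map hZX.aemeasurable hm.aestronglyMeasurable).symm
    _ = ∫ z, ∫ x, inner ℝ z.2 (gradNoise f D i z.1 x) ∂(D i)
          ∂(P.map fun ω => (θ ω, b ω)) := by
        rw [hξ.map_prod h hZ, integral_prod _ hint']
    _ = 0 := by
        simp only [integral_inner ((WeightedGT.memLp_gradNoise hsm hor i _).integrable one_le_two),
          integral_gradNoise hsm hor, inner_zero_right, integral_zero]

lemma memLp_sampleGrad (hξ : IsSampling P D ξ) (hsm : IsSmooth f D β) (hor : IsOracle f D υ)
    {t : ℕ} {i : Fin n} {θ : Ω → Param d} (hθ : Measurable[sampleSigma ξ (before n t)] θ)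
    (hθ2 : MemLp θ 2 P) : MemLp (fun ω => sampleGrad f i (θ ω) (ξ t i ω)) 2 P := by
  have h := (hξ.memLp_gradNoise hsm hor (notMem_before t i) hθ).add (memLp_comp_gradient hsm i hθ2)
  refine (memLp_congr_ae (Filter.Eventually.of_forall fun ω => ?_)).1 h
  simp [gradNoise]

/-- Square integrability propagates by induction: the noise has bounded second moment, the true
gradients grow linearly, and everything else is linear. Finiteness of all the expectations rests on
it. -/
lemma memLp_run (hξ : IsSampling P D ξ) (hsm : IsSmooth f D β) (hor : IsOracle f D υ) (t : ℕ) :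
    (∀ i, MemLp (fun ω => (run f W Gm α ξ θ₀ t ω).1 i) 2 P) ∧
    ∀ i, MemLp (fun ω => (run f W Gm α ξ θ₀ t ω).2 i) 2 P := by
  have hmeas := fun t => (measurable_run (W := W) (Gm := Gm) (α := α) (θ₀ := θ₀) (ξ := ξ) hor t).1
  induction t with
  | zero =>
    refine ⟨fun i => memLp_const θ₀, fun i => ?_⟩
    change MemLp (fun ω => ∑ j, Gm i j • sampleGrad f j θ₀ (ξ 0 j ω)) 2 P
    exact memLp_finsetSum _ fun j _ =>
      (memLp_sampleGrad hξ hsm hor measurable_const (memLp_const θ₀)).const_smul (Gm i j)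
  | succ t ih =>
    obtain ⟨h1, h2⟩ := ih
    have h3 : ∀ i, MemLp (fun ω => (run f W Gm α ξ θ₀ (t + 1) ω).1 i) 2 P := by
      intro i
      change MemLp (fun ω => ∑ j, W i j •
        ((run f W Gm α ξ θ₀ t ω).1 j - α • (run f W Gm α ξ θ₀ t ω).2 j)) 2 P
      exact memLp_finsetSum _ fun j _ => ((h1 j).sub ((h2 j).const_smul α)).const_smul (W i j)
    refine ⟨h3, fun i => ?_⟩
    change MemLp (fun ω => ∑ j, W i j • (run f W Gm α ξ θ₀ t ω).2 j +
      ∑ j, Gm i j • (sampleGrad f j ((run f W Gm α ξ θ₀ (t + 1) ω).1 j) (ξ (t + 1) j ω)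
        - sampleGrad f j ((run f W Gm α ξ θ₀ t ω).1 j) (ξ t j ω))) 2 P
    exact (memLp_finsetSum _ fun j _ => (h2 j).const_smul (W i j)).add
      (memLp_finsetSum _ fun j _ => ((memLp_sampleGrad hξ hsm hor (hmeas _ j) (h3 j)).sub
        (memLp_sampleGrad hξ hsm hor (hmeas _ j) (h1 j))).const_smul (Gm i j))

end

section

/-! ### Matrices acting on stacked vectors -/

section Stack

variable {n d : ℕ}

lemma act_act (A B : Matrix (Fin n) (Fin n) ℝ) (X : Fin n → Param d) :
    act A (act B X) = act (A * B) X := by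
  funext i
  simp only [act, Matrix.mul_apply, Finset.sum_smul, Finset.smul_sum, smul_smul]
  exact Finset.sum_comm

lemma act_add (A : Matrix (Fin n) (Fin n) ℝ) (X Y : Fin n → Param d) :
    act A (X + Y) = act A X + act A Y := by
  funext i; simp [act, Finset.sum_add_distrib]

lemma act_sub (A : Matrix (Fin n) (Fin n) ℝ) (X Y : Fin n → Param d) :
    act A (X - Y) = act A X - act A Y := by
  funext i; simp [act, smul_sub, Finset.sum_sub_distrib]

lemma act_smul (A : Matrix (Fin n) (Fin n) ℝ) (c : ℝ) (X : Fin n → Param d) :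
    act A (c • X) = c • act A X := by
  funext i; simp [act, Finset.smul_sum, smul_comm c]

lemma act_diagonal (m : Fin n → ℝ) (X : Fin n → Param d) :
    act (Matrix.diagonal m) X = fun i => m i • X i := by
  funext i
  rw [act, Finset.sum_eq_single i]
  · simp
  · intro j _ hj; simp [Matrix.diagonal_apply_ne' _ hj]
  · simp

lemma act_one (X : Fin n → Param d) : act 1 X = X := by
  rw [← Matrix.diagonal_one, act_diagonal]; simp

lemma sub_act (A B : Matrix (Fin n) (Fin n) ℝ) (X : Fin n → Param d) :
    act (A - B) X = act A X - act B X := by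
  funext i; simp [act, sub_smul, Finset.sum_sub_distrib]

lemma act_lamMat (w : Fin n → ℝ) (X : Fin n → Param d) : act (lamMat w) X = fun _ => wAvg w X := by
  funext i
  simp [act, lamMat, wAvg, Finset.smul_sum, smul_smul, div_eq_inv_mul]

lemma act_one_sub_lamMat (w : Fin n → ℝ) (X : Fin n → Param d) (i : Fin n) :
    act (1 - lamMat w) X i = X i - wAvg w X := by
  rw [sub_act, act_one, act_lamMat]; rfl

lemma wAvg_add (w : Fin n → ℝ) (X Y : Fin n → Param d) :
    wAvg w (X + Y) = wAvg w X + wAvg w Y := by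
  simp [wAvg, Finset.sum_add_distrib]

lemma wAvg_sub (w : Fin n → ℝ) (X Y : Fin n → Param d) :
    wAvg w (X - Y) = wAvg w X - wAvg w Y := by
  simp [wAvg, smul_sub, Finset.sum_sub_distrib]

lemma wAvg_smul (w : Fin n → ℝ) (c : ℝ) (X : Fin n → Param d) :
    wAvg w (c • X) = c • wAvg w X := by
  simp only [wAvg, Pi.smul_apply, smul_comm _ c, ← Finset.smul_sum]

lemma wAvg_const [NeZero n] {w : Fin n → ℝ} (hsum : ∑ i, w i = n) (θ : Param d) :
    wAvg w (fun _ => θ) = θ := by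
  have hn : (n : ℝ) ≠ 0 := NeZero.ne _
  rw [wAvg, ← Finset.sum_smul, hsum, smul_smul, one_div, inv_mul_cancel₀ hn, one_smul]

lemma IsMixing.wAvg_act {G : SimpleGraph (Fin n)} {w : Fin n → ℝ} {W : Matrix (Fin n) (Fin n) ℝ}
    (hW : IsMixing G w W) (X : Fin n → Param d) : wAvg w (act W X) = wAvg w X := by
  simp only [wAvg, act, Finset.smul_sum, smul_smul]
  rw [Finset.sum_comm]
  refine Finset.sum_congr rfl fun j _ => ?_
  rw [← Finset.sum_smul]
  simp only [← Finset.mul_sum, hW.col_sum]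

/-- The space of stacked vectors with its Frobenius norm. -/
abbrev Stack (n d : ℕ) : Type := PiLp 2 fun _ : Fin n => Param d

/-- The isometry from the `w`-weighted Frobenius norm to the unweighted one. -/
def wEmbed (w : Fin n → ℝ) (X : Fin n → Param d) : Stack n d :=
  WithLp.toLp 2 fun i => √(w i) • X i

lemma norm_wEmbed_sq {w : Fin n → ℝ} (hw : ∀ i, 0 ≤ w i) (X : Fin n → Param d) :
    ‖wEmbed w X‖ ^ 2 = wFrobSq w X := by
  rw [PiLp.norm_sq_eq_of_L2, wFrobSq]
  refine Finset.sum_congr rfl fun i _ => ?_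
  simp [wEmbed, norm_smul, mul_pow, Real.sq_sqrt (hw i)]

lemma wEmbed_add (w : Fin n → ℝ) (X Y : Fin n → Param d) :
    wEmbed w (X + Y) = wEmbed w X + wEmbed w Y := by
  ext1 i; simp [wEmbed]

lemma wEmbed_sub (w : Fin n → ℝ) (X Y : Fin n → Param d) :
    wEmbed w (X - Y) = wEmbed w X - wEmbed w Y := by
  ext1 i; simp [wEmbed, smul_sub]

lemma wEmbed_smul (w : Fin n → ℝ) (c : ℝ) (X : Fin n → Param d) :
    wEmbed w (c • X) = c • wEmbed w X := by
  ext1 i; simp [wEmbed, smul_comm c]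

lemma wEmbed_surjective {w : Fin n → ℝ} (hw : ∀ i, 0 < w i) :
    Function.Surjective (wEmbed w : (Fin n → Param d) → Stack n d) := fun v =>
  ⟨fun i => (√(w i))⁻¹ • v i, by
    ext1 i; simp [wEmbed, smul_smul, mul_inv_cancel₀ (Real.sqrt_pos.2 (hw i)).ne']⟩

/-- The linear map on stacked vectors that is given by a matrix. -/
def matLin (S : Matrix (Fin n) (Fin n) ℝ) : Stack n d →ₗ[ℝ] Stack n d where
  toFun v := WithLp.toLp 2 (act S v.ofLp)
  map_add' u v := by rw [WithLp.ofLp_add, act_add, WithLp.toLp_add]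
  map_smul' c v := by rw [WithLp.ofLp_smul, act_smul, WithLp.toLp_smul, RingHom.id_apply]

/-- The operator on stacked vectors that is given by a matrix. -/
def matOp (S : Matrix (Fin n) (Fin n) ℝ) : Stack n d →L[ℝ] Stack n d :=
  ⟨matLin S, (PiLp.continuous_toLp 2 _).comp (continuous_pi fun i =>
    continuous_finsetSum _ fun j _ =>
      ((continuous_apply j).comp (PiLp.continuous_ofLp 2 _)).const_smul (S i j))⟩

lemma matOp_apply (S : Matrix (Fin n) (Fin n) ℝ) (v : Stack n d) :
    matOp S v = WithLp.toLp 2 (act S v.ofLp) := rfl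

/-- `wEmbed w` intertwines `A` with its conjugate, so estimates in the weighted norm reduce to
symmetric matrices in the ordinary one. -/
lemma matOp_conjSqrt {w : Fin n → ℝ} (hw : ∀ i, 0 < w i) (A : Matrix (Fin n) (Fin n) ℝ)
    (X : Fin n → Param d) : matOp (conjSqrt w A) (wEmbed w X) = wEmbed w (act A X) := by
  ext1 i
  simp only [matOp_apply, wEmbed, act, conjSqrt, Matrix.of_apply, Finset.smul_sum, smul_smul]
  refine Finset.sum_congr rfl fun j _ => ?_
  rw [div_mul_cancel₀ _ (Real.sqrt_pos.2 (hw j)).ne']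

/-- The matrix acts on each of the `d` coordinates separately, so the scalar contraction can be
summed over the coordinates. -/
lemma norm_matOp_le {S : Matrix (Fin n) (Fin n) ℝ} (hS : S.IsSymm) (v : Stack n d) :
    ‖matOp S v‖ ≤ specRad S * ‖v‖ := by
  have h : ‖matOp S v‖ ^ 2 ≤ (specRad S * ‖v‖) ^ 2 := by
    rw [mul_pow, PiLp.norm_sq_eq_of_L2, PiLp.norm_sq_eq_of_L2]
    simp only [EuclideanSpace.norm_sq_eq, Real.norm_eq_abs, sq_abs, matOp_apply, act]
    rw [Finset.sum_comm, Finset.sum_comm (γ := Fin n), Finset.mul_sum]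
    refine Finset.sum_le_sum fun c _ => ?_
    simpa using sum_mulVec_sq_le hS fun j => v j c
  exact (sq_le_sq₀ (norm_nonneg _) (mul_nonneg (specRad_nonneg S) (norm_nonneg _))).1 h

end Stack

/-! ### Consensus errors along the run -/

section Run

variable {n d : ℕ} {Ξ Ω : Type*} {f : Fin n → Param d → Ξ → ℝ}
  {ξ : ℕ → Fin n → Ω → Ξ} {G : SimpleGraph (Fin n)} {w m : Fin n → ℝ}
  {W : Matrix (Fin n) (Fin n) ℝ} {α : ℝ} {θ₀ : Param d}

/-- The stacked sample gradients of iteration `t`. -/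
def gradStack (f : Fin n → Param d → Ξ → ℝ) (W Gm : Matrix (Fin n) (Fin n) ℝ) (α : ℝ)
    (ξ : ℕ → Fin n → Ω → Ξ) (θ₀ : Param d) (t : ℕ) (ω : Ω) : Fin n → Param d :=
  fun i => sampleGrad f i ((run f W Gm α ξ θ₀ t ω).1 i) (ξ t i ω)

lemma run_succ_fst (Gm : Matrix (Fin n) (Fin n) ℝ) (t : ℕ) (ω : Ω) :
    (run f W Gm α ξ θ₀ (t + 1) ω).1
      = act W ((run f W Gm α ξ θ₀ t ω).1 - α • (run f W Gm α ξ θ₀ t ω).2) := rfl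

lemma run_succ_snd (Gm : Matrix (Fin n) (Fin n) ℝ) (t : ℕ) (ω : Ω) :
    (run f W Gm α ξ θ₀ (t + 1) ω).2 = act W (run f W Gm α ξ θ₀ t ω).2
      + act Gm (gradStack f W Gm α ξ θ₀ (t + 1) ω - gradStack f W Gm α ξ θ₀ t ω) := rfl

lemma wAvg_act_diagonal {lam : Fin n → ℝ} (hwm : ∀ i, w i * m i = lam i) (X : Fin n → Param d) :
    wAvg w (act (Matrix.diagonal m) X) = wAvg lam X := by
  simp only [act_diagonal, wAvg, smul_smul, hwm]

/-- The average of the trackers is the average of the current sample gradients. -/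
lemma wAvg_run_snd (hW : IsMixing G w W) {lam : Fin n → ℝ} (hwm : ∀ i, w i * m i = lam i)
    (t : ℕ) (ω : Ω) : wAvg w (run f W (Matrix.diagonal m) α ξ θ₀ t ω).2
      = wAvg lam (gradStack f W (Matrix.diagonal m) α ξ θ₀ t ω) := by
  induction t with
  | zero => exact wAvg_act_diagonal hwm _
  | succ t ih =>
    rw [run_succ_snd, wAvg_add, hW.wAvg_act, ih, wAvg_act_diagonal hwm, wAvg_sub]
    abel

lemma wAvg_run_fst_succ (hW : IsMixing G w W) {lam : Fin n → ℝ} (hwm : ∀ i, w i * m i = lam i)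
    (t : ℕ) (ω : Ω) : wAvg w (run f W (Matrix.diagonal m) α ξ θ₀ (t + 1) ω).1
      = wAvg w (run f W (Matrix.diagonal m) α ξ θ₀ t ω).1
        - α • wAvg lam (gradStack f W (Matrix.diagonal m) α ξ θ₀ t ω) := by
  rw [run_succ_fst, hW.wAvg_act, wAvg_sub, wAvg_smul, wAvg_run_snd hW hwm]

/-- The embedded consensus error of the parameters. -/
def errΘ (f : Fin n → Param d → Ξ → ℝ) (w m : Fin n → ℝ) (W : Matrix (Fin n) (Fin n) ℝ) (α : ℝ)
    (ξ : ℕ → Fin n → Ω → Ξ) (θ₀ : Param d) (t : ℕ) (ω : Ω) : Stack n d :=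
  wEmbed w (act (1 - lamMat w) (run f W (Matrix.diagonal m) α ξ θ₀ t ω).1)

/-- The embedded and scaled consensus error of the trackers. -/
def errY (f : Fin n → Param d → Ξ → ℝ) (w m : Fin n → ℝ) (W : Matrix (Fin n) (Fin n) ℝ) (α : ℝ)
    (ξ : ℕ → Fin n → Ω → Ξ) (θ₀ : Param d) (t : ℕ) (ω : Ω) : Stack n d :=
  wEmbed w (α • act (1 - lamMat w) (run f W (Matrix.diagonal m) α ξ θ₀ t ω).2)

/-- The embedded mixing operator with the average removed. -/
def mixOp (w : Fin n → ℝ) (W : Matrix (Fin n) (Fin n) ℝ) : Stack n d →L[ℝ] Stack n d :=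
  matOp (conjSqrt w (W - lamMat w))

/-- The embedded projection onto consensus errors. -/
def projOp (w : Fin n → ℝ) : Stack n d →L[ℝ] Stack n d :=
  matOp (conjSqrt w (1 - lamMat w))

lemma IsMixing.norm_mixOp_le (hW : IsMixing G w W) (hw : ∀ i, 0 < w i) (v : Stack n d) :
    ‖mixOp w W v‖ ≤ specRad (W - lamMat w) * ‖v‖ := by
  rw [← specRad_conjSqrt hw]
  refine norm_matOp_le (conjSqrt_isSymm hw fun i j => ?_) v
  simp only [Matrix.sub_apply, mul_sub, hW.detailed_balance i j, lamMat, Matrix.of_apply]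
  ring

lemma IsMixing.proj_mul (hW : IsMixing G w W) : (1 - lamMat w) * W = W - lamMat w := by
  rw [sub_mul, one_mul, hW.lamMat_mul]

variable [NeZero n]

/-- With `IsMixing.proj_mul`, this lets the projection pass through a mixing step, so that the
consensus errors satisfy a closed recursion. -/
lemma IsMixing.sub_mul_proj (hW : IsMixing G w W) (hsum : ∑ i, w i = n) :
    (W - lamMat w) * (1 - lamMat w) = W - lamMat w := by
  rw [sub_mul, mul_sub, mul_sub, mul_one, mul_one, hW.mul_lamMat, lamMat_mul_lamMat hsum]
  abel

lemma IsMixing.mixOp_projOp (hW : IsMixing G w W) (hw : ∀ i, 0 < w i) (hsum : ∑ i, w i = n)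
    (v : Stack n d) : mixOp w W (projOp w v) = mixOp w W v := by
  obtain ⟨X, rfl⟩ := wEmbed_surjective hw v
  simp only [mixOp, projOp, matOp_conjSqrt hw, act_act, hW.sub_mul_proj hsum]

/-- All nodes start at the same point; hence only the trackers contribute an initial error. -/
lemma errΘ_zero (hsum : ∑ i, w i = n) (ω : Ω) : errΘ f w m W α ξ θ₀ 0 ω = 0 := by
  have : act (1 - lamMat w) (run f W (Matrix.diagonal m) α ξ θ₀ 0 ω).1 = 0 := by
    funext i
    rw [act_one_sub_lamMat]
    change θ₀ - wAvg w (fun _ => θ₀) = 0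
    rw [wAvg_const hsum, sub_self]
  rw [errΘ, this]
  ext1 i; simp [wEmbed]

lemma errΘ_succ (hW : IsMixing G w W) (hw : ∀ i, 0 < w i) (hsum : ∑ i, w i = n) (t : ℕ) (ω : Ω) :
    errΘ f w m W α ξ θ₀ (t + 1) ω
      = mixOp w W (errΘ f w m W α ξ θ₀ t ω - errY f w m W α ξ θ₀ t ω) := by
  rw [errΘ, run_succ_fst, act_act, hW.proj_mul, ← hW.sub_mul_proj hsum, errΘ, errY, ← wEmbed_sub,
    mixOp, matOp_conjSqrt hw, ← act_smul, ← act_sub, act_act]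

lemma errY_succ (hW : IsMixing G w W) (hw : ∀ i, 0 < w i) (hsum : ∑ i, w i = n) (t : ℕ) (ω : Ω) :
    errY f w m W α ξ θ₀ (t + 1) ω
      = mixOp w W (errY f w m W α ξ θ₀ t ω) + projOp w (α • wEmbed w (act (Matrix.diagonal m)
        (gradStack f W (Matrix.diagonal m) α ξ θ₀ (t + 1) ω
          - gradStack f W (Matrix.diagonal m) α ξ θ₀ t ω))) := by
  rw [errY, run_succ_snd, act_add, act_act, hW.proj_mul, ← hW.sub_mul_proj hsum, errY,
    mixOp, matOp_conjSqrt hw, projOp, ← wEmbed_smul, matOp_conjSqrt hw, ← wEmbed_add, act_smul,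
    act_smul, smul_add, act_act, act_act]

end Run

end

section

/-! ### Smoothness of the global loss -/

section Smooth

/-- The descent lemma. -/
lemma le_add_inner_gradient_add {E : Type*} [NormedAddCommGroup E] [InnerProductSpace ℝ E]
    [CompleteSpace E] {g : E → ℝ} {β : ℝ} (hg : Differentiable ℝ g)
    (hlip : ∀ x y, ‖gradient g x - gradient g y‖ ≤ β * ‖x - y‖) (x v : E) :
    g (x + v) ≤ g x + inner ℝ (gradient g x) v + β / 2 * ‖v‖ ^ 2 := by
  -- The gap along the segment has nonpositive derivative by the Lipschitz bound; comparison of its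
  -- values at 0 and 1 gives the claim without an integral formula.
  let h : ℝ → ℝ := fun s => g (x + s • v) - s * inner ℝ (gradient g x) v - β / 2 * ‖v‖ ^ 2 * s ^ 2
  have hd : ∀ s, HasDerivAt h (inner ℝ (gradient g (x + s • v)) v - inner ℝ (gradient g x) v
      - β / 2 * ‖v‖ ^ 2 * (2 * s)) s := by
    intro s
    have h1 : HasDerivAt (fun s : ℝ => x + s • v) v s := by
      simpa using ((hasDerivAt_id s).smul_const v).const_add x
    have h2 := (hg (x + s • v)).hasGradientAt.hasFDerivAt.comp_hasDerivAt s h1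
    have h3 := (hasDerivAt_id s).mul_const (inner ℝ (gradient g x) v)
    have h4 := ((hasDerivAt_id s).pow 2).const_mul (β / 2 * ‖v‖ ^ 2)
    refine ((h2.sub h3).sub h4).congr_deriv ?_
    simp
  have hanti : AntitoneOn h (Set.Icc 0 1) := by
    refine antitoneOn_of_deriv_nonpos (convex_Icc 0 1)
      (fun s _ => (hd s).continuousAt.continuousWithinAt)
      (fun s _ => (hd s).differentiableAt.differentiableWithinAt) fun s hs => ?_
    rw [interior_Icc] at hs
    rw [(hd s).deriv, ← inner_sub_left]
    have h5 := (real_inner_le_norm (gradient g (x + s • v) - gradient g x) v).trans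
      (mul_le_mul_of_nonneg_right (hlip (x + s • v) x) (norm_nonneg v))
    rw [add_sub_cancel_left, norm_smul, Real.norm_of_nonneg hs.1.le] at h5
    linarith
  have := hanti (Set.left_mem_Icc.2 zero_le_one) (Set.right_mem_Icc.2 zero_le_one) zero_le_one
  simp only [h, one_smul, zero_smul, add_zero] at this
  linarith

/-- Jensen's inequality for the probability weights `lam i / n`. -/
lemma norm_sq_wAvg_le {n d : ℕ} [NeZero n] {lam : Fin n → ℝ} (hlam : ∀ i, 0 ≤ lam i)
    (hsum : ∑ i, lam i = n) (X : Fin n → Param d) :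
    ‖wAvg lam X‖ ^ 2 ≤ (1 / (n : ℝ)) * ∑ i, lam i * ‖X i‖ ^ 2 := by
  have hn : (0 : ℝ) < n := by exact_mod_cast NeZero.pos n
  have h1 : ‖∑ i, lam i • X i‖ ^ 2 ≤ n * ∑ i, lam i * ‖X i‖ ^ 2 := by
    rw [← hsum]
    refine (pow_le_pow_left₀ (norm_nonneg _) (norm_sum_le _ _) 2).trans
      (Finset.sum_sq_le_sum_mul_sum_of_sq_le_mul _ (fun i _ => hlam i)
        (fun i _ => mul_nonneg (hlam i) (sq_nonneg _)) fun i _ => le_of_eq ?_)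
    rw [norm_smul, Real.norm_of_nonneg (hlam i)]; ring
  rw [wAvg, norm_smul, mul_pow, Real.norm_of_nonneg (by positivity)]
  calc _ ≤ (1 / (n : ℝ)) ^ 2 * (n * ∑ i, lam i * ‖X i‖ ^ 2) :=
        mul_le_mul_of_nonneg_left h1 (sq_nonneg _)
    _ = _ := by field_simp

variable {n d : ℕ} {Ξ : Type*} [MeasurableSpace Ξ] {f : Fin n → Param d → Ξ → ℝ}
  {D : Fin n → Measure Ξ} {β : ℝ} {lam : Fin n → ℝ}

lemma IsSmooth.hasGradientAt_globalLoss (hsm : IsSmooth f D β) (θ : Param d) :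
    HasGradientAt (globalLoss lam f D)
      (wAvg lam fun i => gradient (localLoss f D i) θ) θ := by
  have h : HasFDerivAt (globalLoss lam f D) ((1 / (n : ℝ)) •
      ∑ i, lam i • (InnerProductSpace.toDual ℝ (Param d)) (gradient (localLoss f D i) θ)) θ := by
    refine HasFDerivAt.const_mul (HasFDerivAt.fun_sum fun i _ => ?_) _
    exact (hsm.differentiable i θ).hasGradientAt.hasFDerivAt.const_mul (lam i)
  have e : InnerProductSpace.toDual ℝ (Param d) (wAvg lam fun i => gradient (localLoss f D i) θ)
      = (1 / (n : ℝ)) •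
        ∑ i, lam i • (InnerProductSpace.toDual ℝ (Param d)) (gradient (localLoss f D i) θ) := by
    simp only [wAvg, map_smul, map_sum]
  rw [hasGradientAt_iff_hasFDerivAt, e]
  exact h

lemma IsSmooth.gradient_globalLoss (hsm : IsSmooth f D β) (θ : Param d) :
    gradient (globalLoss lam f D) θ = wAvg lam fun i => gradient (localLoss f D i) θ :=
  (hsm.hasGradientAt_globalLoss θ).gradient

lemma IsSmooth.differentiable_globalLoss (hsm : IsSmooth f D β) :
    Differentiable ℝ (globalLoss lam f D) :=
  fun θ => (hsm.hasGradientAt_globalLoss θ).differentiableAt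

variable [NeZero n]

/-- The error of evaluating the local gradients at different points. -/
lemma IsSmooth.norm_sq_gradient_globalLoss_sub_le (hsm : IsSmooth f D β) (hlam : ∀ i, 0 ≤ lam i)
    (hsum : ∑ i, lam i = n) (θ : Param d) (Θ : Fin n → Param d) :
    ‖gradient (globalLoss lam f D) θ - wAvg lam (fun i => gradient (localLoss f D i) (Θ i))‖ ^ 2
      ≤ β ^ 2 * ((1 / (n : ℝ)) * ∑ i, lam i * ‖Θ i - θ‖ ^ 2) := by
  rw [hsm.gradient_globalLoss, ← wAvg_sub]
  refine (norm_sq_wAvg_le hlam hsum _).trans ?_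
  rw [mul_left_comm (β ^ 2), Finset.mul_sum (a := β ^ 2)]
  refine mul_le_mul_of_nonneg_left (Finset.sum_le_sum fun i _ => ?_)
    (by positivity : (0 : ℝ) ≤ 1 / n)
  rw [mul_left_comm (β ^ 2), ← mul_pow, norm_sub_rev (Θ i)]
  exact mul_le_mul_of_nonneg_left
    (pow_le_pow_left₀ (norm_nonneg _) (hsm.lipschitz i θ (Θ i)) 2) (hlam i)

lemma IsSmooth.lipschitz_gradient_globalLoss (hsm : IsSmooth f D β) (hβ : 0 ≤ β)
    (hlam : ∀ i, 0 ≤ lam i) (hsum : ∑ i, lam i = n) (θ₁ θ₂ : Param d) :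
    ‖gradient (globalLoss lam f D) θ₁ - gradient (globalLoss lam f D) θ₂‖ ≤ β * ‖θ₁ - θ₂‖ := by
  have hn : (n : ℝ) ≠ 0 := NeZero.ne _
  have h := hsm.norm_sq_gradient_globalLoss_sub_le hlam hsum θ₁ fun _ => θ₂
  rw [← hsm.gradient_globalLoss, ← Finset.sum_mul, hsum, ← mul_assoc (1 / (n : ℝ)),
    one_div_mul_cancel hn, one_mul, ← mul_pow, norm_sub_rev θ₂] at h
  exact (sq_le_sq₀ (norm_nonneg _) (mul_nonneg hβ (norm_nonneg _))).1 h

end Smooth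

/-! ### Moments along the run -/

section Moments

variable {n d : ℕ} {Ξ Ω : Type*} [MeasurableSpace Ξ]
  {f : Fin n → Param d → Ξ → ℝ} {D : Fin n → Measure Ξ}
  {ξ : ℕ → Fin n → Ω → Ξ} {β υ : ℝ} {G : SimpleGraph (Fin n)} {w m lam : Fin n → ℝ}
  {W Gm : Matrix (Fin n) (Fin n) ℝ} {α : ℝ} {θ₀ : Param d}

/-- The stacked local gradients at the parameters of iteration `t`. -/
def trueGrad (f : Fin n → Param d → Ξ → ℝ) (D : Fin n → Measure Ξ)
    (W Gm : Matrix (Fin n) (Fin n) ℝ) (α : ℝ) (ξ : ℕ → Fin n → Ω → Ξ) (θ₀ : Param d) (t : ℕ)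
    (ω : Ω) : Fin n → Param d :=
  fun i => gradient (localLoss f D i) ((run f W Gm α ξ θ₀ t ω).1 i)

/-- The stacked gradient noise of iteration `t`. -/
def noise (f : Fin n → Param d → Ξ → ℝ) (D : Fin n → Measure Ξ)
    (W Gm : Matrix (Fin n) (Fin n) ℝ) (α : ℝ) (ξ : ℕ → Fin n → Ω → Ξ) (θ₀ : Param d) (t : ℕ)
    (ω : Ω) : Fin n → Param d :=
  fun i => gradNoise f D i ((run f W Gm α ξ θ₀ t ω).1 i) (ξ t i ω)

lemma gradStack_eq (t : ℕ) (ω : Ω) : gradStack f W Gm α ξ θ₀ t ω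
    = trueGrad f D W Gm α ξ θ₀ t ω + noise f D W Gm α ξ θ₀ t ω := by
  funext i; simp [gradStack, trueGrad, noise, gradNoise]

lemma measurable_wAvg {mΩ : MeasurableSpace Ω} {X : Ω → Fin n → Param d}
    (hX : ∀ i, Measurable fun ω => X ω i) : Measurable fun ω => wAvg w (X ω) :=
  (Finset.measurable_fun_sum _ fun j _ => (hX j).const_smul (w j)).const_smul (1 / (n : ℝ))

lemma measurable_noise (hsm : IsSmooth f D β) (hor : IsOracle f D υ) {S : Set (ℕ × Fin n)}
    {t : ℕ} {i : Fin n} (hS : before n t ⊆ S) (hi : (t, i) ∈ S) :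
    Measurable[sampleSigma ξ S] fun ω => noise f D W Gm α ξ θ₀ t ω i :=
  measurable_gradNoise_comp hsm hor i
    (((measurable_run hor t).1 i).mono (sampleSigma_mono ξ hS) le_rfl) (measurable_sample ξ hi)

variable [MeasurableSpace Ω] {P : Measure Ω}

lemma memLp_wEmbed {X : Ω → Fin n → Param d} (hX : ∀ i, MemLp (fun ω => X ω i) 2 P) :
    MemLp (fun ω => wEmbed w (X ω)) 2 P :=
  MemLp.of_eval_piLp fun i => (hX i).const_smul (√(w i))

lemma memLp_act {X : Ω → Fin n → Param d} (hX : ∀ i, MemLp (fun ω => X ω i) 2 P)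
    (A : Matrix (Fin n) (Fin n) ℝ) (i : Fin n) : MemLp (fun ω => act A (X ω) i) 2 P :=
  memLp_finsetSum _ fun j _ => (hX j).const_smul (A i j)

lemma memLp_wAvg {X : Ω → Fin n → Param d} (hX : ∀ i, MemLp (fun ω => X ω i) 2 P) :
    MemLp (fun ω => wAvg w (X ω)) 2 P :=
  (memLp_finsetSum _ fun j _ => (hX j).const_smul (w j)).const_smul (1 / (n : ℝ))

variable [IsProbabilityMeasure P] [∀ i, IsProbabilityMeasure (D i)]

lemma memLp_trueGrad (hξ : IsSampling P D ξ) (hsm : IsSmooth f D β) (hor : IsOracle f D υ) (t : ℕ)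
    (i : Fin n) : MemLp (fun ω => trueGrad f D W Gm α ξ θ₀ t ω i) 2 P :=
  memLp_comp_gradient hsm i ((memLp_run hξ hsm hor t).1 i)

lemma memLp_noise (hξ : IsSampling P D ξ) (hsm : IsSmooth f D β) (hor : IsOracle f D υ) (t : ℕ)
    (i : Fin n) : MemLp (fun ω => noise f D W Gm α ξ θ₀ t ω i) 2 P :=
  hξ.memLp_gradNoise hsm hor (notMem_before t i) ((measurable_run hor t).1 i)

lemma integral_noise_sq_le (hξ : IsSampling P D ξ) (hsm : IsSmooth f D β) (hor : IsOracle f D υ)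
    (t : ℕ) (i : Fin n) : ∫ ω, ‖noise f D W Gm α ξ θ₀ t ω i‖ ^ 2 ∂P ≤ υ ^ 2 :=
  hξ.integral_gradNoise_sq_le hsm hor (notMem_before t i) ((measurable_run hor t).1 i)

lemma integral_inner_noise (hξ : IsSampling P D ξ) (hsm : IsSmooth f D β) (hor : IsOracle f D υ)
    {S : Set (ℕ × Fin n)} {t : ℕ} {i : Fin n} (hS : before n t ⊆ S) (hi : (t, i) ∉ S)
    {b : Ω → Param d} (hb : Measurable[sampleSigma ξ S] b) (hb2 : MemLp b 2 P) :
    ∫ ω, inner ℝ (b ω) (noise f D W Gm α ξ θ₀ t ω i) ∂P = 0 :=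
  hξ.integral_inner_gradNoise hsm hor hi
    (((measurable_run hor t).1 i).mono (sampleSigma_mono ξ hS) le_rfl) hb hb2

lemma integral_inner_wAvg_noise (hξ : IsSampling P D ξ) (hsm : IsSmooth f D β)
    (hor : IsOracle f D υ) (t : ℕ) {b : Ω → Param d}
    (hb : Measurable[sampleSigma ξ (before n t)] b) (hb2 : MemLp b 2 P) :
    ∫ ω, inner ℝ (b ω) (wAvg lam (noise f D W Gm α ξ θ₀ t ω)) ∂P = 0 := by
  simp only [wAvg, inner_smul_right, inner_sum]
  rw [integral_const_mul, integral_finsetSum _ fun i _ =>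
    (integrable_inner_of_memLp hb2 (memLp_noise hξ hsm hor t i)).const_mul _]
  simp only [integral_const_mul,
    integral_inner_noise hξ hsm hor subset_rfl (notMem_before t _) hb hb2, mul_zero,
    Finset.sum_const_zero]

/-- Independent node noises average out. -/
lemma integral_wAvg_noise_sq_le (hξ : IsSampling P D ξ) (hsm : IsSmooth f D β)
    (hor : IsOracle f D υ) (t : ℕ) :
    ∫ ω, ‖wAvg lam (noise f D W Gm α ξ θ₀ t ω)‖ ^ 2 ∂P ≤ cLam lam * υ ^ 2 := by
  have horth : ∀ i ∈ Finset.univ, ∀ j ∈ Finset.univ, i ≠ j →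
      ∫ ω, inner ℝ (lam i • noise f D W Gm α ξ θ₀ t ω i)
        (lam j • noise f D W Gm α ξ θ₀ t ω j) ∂P = 0 := by
    intro i _ j _ hij
    -- For two nodes in the same iteration the history before `t` is too small: the noise of node
    -- `i` uses the sample `(t, i)`. The σ-algebra of all samples except `(t, j)` serves instead.
    have h := integral_inner_noise (W := W) (Gm := Gm) (α := α) (θ₀ := θ₀) (t := t) (i := j)
      hξ hsm hor (S := {(t, j)}ᶜ)
      (fun p hp h => notMem_before t j (h ▸ hp)) (fun h => h rfl)
      (measurable_noise (W := W) (Gm := Gm) (α := α) (θ₀ := θ₀) (t := t) (i := i) hsm hor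
        (fun p hp h => notMem_before t j (h ▸ hp)) (by simpa using hij))
      (memLp_noise hξ hsm hor t i)
    simp only [inner_smul_left, inner_smul_right, integral_const_mul, h, mul_zero]
  simp only [wAvg, norm_smul, mul_pow]
  rw [integral_const_mul, integral_normSq_sum_of_orthogonal _
    (v := fun i ω => lam i • noise f D W Gm α ξ θ₀ t ω i)
    (fun i _ => (memLp_noise hξ hsm hor t i).const_smul (lam i)) horth, cLam, mul_assoc,
    Finset.sum_mul]
  simp only [norm_smul, mul_pow, Real.norm_eq_abs, sq_abs, integral_const_mul, one_div, inv_pow]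
  gcongr with i
  exact integral_noise_sq_le hξ hsm hor t i

/-- The noise contributions to the trackers are uncorrelated in time. -/
lemma integral_inner_wEmbed_noise (hξ : IsSampling P D ξ) (hsm : IsSmooth f D β)
    (hor : IsOracle f D υ) (A B : Stack n d →L[ℝ] Stack n d) {k l : ℕ} (hkl : k ≠ l) :
    ∫ ω, inner ℝ (A (wEmbed w (fun i => m i • noise f D W Gm α ξ θ₀ k ω i)))
      (B (wEmbed w (fun i => m i • noise f D W Gm α ξ θ₀ l ω i))) ∂P = 0 := by
  have key : ∀ (A B : Stack n d →L[ℝ] Stack n d) {k l : ℕ}, k < l →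
      ∫ ω, inner ℝ (A (wEmbed w (fun i => m i • noise f D W Gm α ξ θ₀ k ω i)))
      (B (wEmbed w (fun i => m i • noise f D W Gm α ξ θ₀ l ω i))) ∂P = 0 := by
    intro A B k l hkl
    -- Moving `B` to the other side by its adjoint leaves the later noise bare, so that it pairs
    -- node by node with a vector determined by earlier samples.
    set b : Ω → Stack n d := fun ω => ContinuousLinearMap.adjoint B
      (A (wEmbed w (fun i => m i • noise f D W Gm α ξ θ₀ k ω i))) with hb
    have hbm : ∀ i, Measurable[sampleSigma ξ (before n l)] fun ω => b ω i := by
      intro i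
      have h1 : Measurable[sampleSigma ξ (before n l)] fun ω =>
          (wEmbed w (fun i => m i • noise f D W Gm α ξ θ₀ k ω i) : Stack n d) := by
        have h0 : Measurable[sampleSigma ξ (before n l)] fun ω i =>
            √(w i) • m i • noise f D W Gm α ξ θ₀ k ω i :=
          @measurable_pi_lambda _ _ _ (sampleSigma ξ (before n l)) _ _ fun i =>
            ((measurable_noise (W := W) (Gm := Gm) (α := α) (θ₀ := θ₀) (i := i) hsm hor
              (before_mono hkl.le) hkl).const_smul (m i)).const_smul (√(w i))
        exact (WithLp.measurable_toLp 2 _).comp h0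
      have h2 : Continuous fun v : Stack n d => ContinuousLinearMap.adjoint B (A v) i :=
        (PiLp.continuous_apply 2 _ i).comp
          ((ContinuousLinearMap.adjoint B).continuous.comp A.continuous)
      exact h2.measurable.comp h1
    have hb2 : MemLp b 2 P := (ContinuousLinearMap.adjoint B).comp_memLp'
      (A.comp_memLp' (memLp_wEmbed fun i => (memLp_noise hξ hsm hor k i).const_smul (m i)))
    have h3 : ∀ ω, inner ℝ (A (wEmbed w (fun i => m i • noise f D W Gm α ξ θ₀ k ω i)))
        (B (wEmbed w (fun i => m i • noise f D W Gm α ξ θ₀ l ω i)))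
        = ∑ i, (√(w i) * m i) * inner ℝ (b ω i) (noise f D W Gm α ξ θ₀ l ω i) := by
      intro ω
      rw [← ContinuousLinearMap.adjoint_inner_left, PiLp.inner_apply]
      simp only [wEmbed, inner_smul_right, mul_assoc, hb]
    simp only [h3]
    rw [integral_finsetSum _ fun i _ => (integrable_inner_of_memLp (hb2.eval_piLp i)
      (memLp_noise hξ hsm hor l i)).const_mul _]
    simp only [integral_const_mul]
    refine Finset.sum_eq_zero fun i _ => ?_
    rw [integral_inner_noise hξ hsm hor subset_rfl (notMem_before l i) (hbm i) (hb2.eval_piLp i),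
      mul_zero]
  rcases hkl.lt_or_gt with h | h
  · exact key A B h
  · simp only [real_inner_comm (B _)] 
    simpa only [real_inner_comm] using key B A h

end Moments

end

section

/-! ### One-step estimates in expectation -/

section Estimates

variable {n d : ℕ} {Ξ Ω : Type*}
  {f : Fin n → Param d → Ξ → ℝ}
  {ξ : ℕ → Fin n → Ω → Ξ} {β υ L : ℝ} {G : SimpleGraph (Fin n)} {w m lam : Fin n → ℝ}
  {W Gm : Matrix (Fin n) (Fin n) ℝ} {α : ℝ} {θ₀ : Param d}

lemma norm_errΘ_sq (hw : ∀ i, 0 < w i) (t : ℕ) (ω : Ω) :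
    ‖errΘ f w m W α ξ θ₀ t ω‖ ^ 2
      = ∑ i, w i * ‖(run f W (Matrix.diagonal m) α ξ θ₀ t ω).1 i
        - wAvg w (run f W (Matrix.diagonal m) α ξ θ₀ t ω).1‖ ^ 2 := by
  rw [errΘ, norm_wEmbed_sq fun i => (hw i).le]
  simp only [wFrobSq, act_one_sub_lamMat]

variable [MeasurableSpace Ξ] {D : Fin n → Measure Ξ}

/-- The change of the local gradients is controlled by the consensus errors and the step. -/
lemma norm_sq_grad_change_le (hsm : IsSmooth f D β) (hw : ∀ i, 0 < w i)
    (hwm : ∀ i, w i * m i = lam i) (hm0 : ∀ i, 0 ≤ m i) (hmL : ∀ i, m i ≤ L)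
    (hlam_sum : ∑ i, lam i = n) (hW : IsMixing G w W) (t : ℕ) (ω : Ω) :
    ‖wEmbed w (fun i => m i • (trueGrad f D W (Matrix.diagonal m) α ξ θ₀ (t + 1) ω i
        - trueGrad f D W (Matrix.diagonal m) α ξ θ₀ t ω i))‖ ^ 2
      ≤ β ^ 2 * (4 * L ^ 2 * (‖errΘ f w m W α ξ θ₀ (t + 1) ω‖ ^ 2
          + ‖errΘ f w m W α ξ θ₀ t ω‖ ^ 2)
        + 2 * L * n * α ^ 2 *
          ‖wAvg lam (gradStack f W (Matrix.diagonal m) α ξ θ₀ t ω)‖ ^ 2) := by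
  rw [norm_wEmbed_sq fun i => (hw i).le, norm_errΘ_sq hw, norm_errΘ_sq hw, wFrobSq,
    ← hlam_sum]
  have hstep := wAvg_run_fst_succ (f := f) (α := α) (ξ := ξ) (θ₀ := θ₀) hW hwm t ω
  set Θ := (run f W (Matrix.diagonal m) α ξ θ₀ t ω).1
  set Θ' := (run f W (Matrix.diagonal m) α ξ θ₀ (t + 1) ω).1
  set g := wAvg lam (gradStack f W (Matrix.diagonal m) α ξ θ₀ t ω)
  have hpt : ∀ i, w i * ‖m i • (trueGrad f D W (Matrix.diagonal m) α ξ θ₀ (t + 1) ω i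
      - trueGrad f D W (Matrix.diagonal m) α ξ θ₀ t ω i)‖ ^ 2
      ≤ β ^ 2 * (4 * L ^ 2 * (w i * ‖Θ' i - wAvg w Θ'‖ ^ 2)
        + 4 * L ^ 2 * (w i * ‖Θ i - wAvg w Θ‖ ^ 2)
        + 2 * L * α ^ 2 * ‖g‖ ^ 2 * lam i) := by
    intro i
    have h1 : ‖trueGrad f D W (Matrix.diagonal m) α ξ θ₀ (t + 1) ω i
        - trueGrad f D W (Matrix.diagonal m) α ξ θ₀ t ω i‖ ^ 2 ≤ β ^ 2 * ‖Θ' i - Θ i‖ ^ 2 := by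
      rw [← mul_pow]
      exact pow_le_pow_left₀ (norm_nonneg _) (hsm.lipschitz i _ _) 2
    -- The displacement is a difference of two consensus errors plus the step of the average;
    -- splitting off the step first gives the constants 4, 4 and 2.
    have h2 : ‖Θ' i - Θ i‖ ^ 2 ≤ 4 * ‖Θ' i - wAvg w Θ'‖ ^ 2 + 4 * ‖Θ i - wAvg w Θ‖ ^ 2
        + 2 * α ^ 2 * ‖g‖ ^ 2 := by
      have h3 : Θ' i - Θ i = (Θ' i - wAvg w Θ') - (Θ i - wAvg w Θ) - α • g := by
        rw [hstep]; abel
      have h4 : ‖Θ' i - Θ i‖ ≤ ‖Θ' i - wAvg w Θ'‖ + ‖Θ i - wAvg w Θ‖ + ‖α • g‖ := by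
        rw [h3]
        exact (norm_sub_le _ _).trans (add_le_add_left (norm_sub_le _ _) _)
      have h5 := pow_le_pow_left₀ (norm_nonneg _) h4 2
      have h6 : α ^ 2 * ‖g‖ ^ 2 = ‖α • g‖ ^ 2 := by
        rw [norm_smul, mul_pow, Real.norm_eq_abs, sq_abs]
      rw [mul_assoc 2, h6]
      nlinarith [sq_nonneg (‖Θ' i - wAvg w Θ'‖ + ‖Θ i - wAvg w Θ‖ - ‖α • g‖),
        sq_nonneg (‖Θ' i - wAvg w Θ'‖ - ‖Θ i - wAvg w Θ‖)]
    have hm2 : m i ^ 2 ≤ L ^ 2 := pow_le_pow_left₀ (hm0 i) (hmL i) 2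
    have hw0 := (hw i).le
    have hlam0 : 0 ≤ lam i := by rw [← hwm]; exact mul_nonneg hw0 (hm0 i)
    -- Only one factor `m i` is bounded by `L` here; the other combines with `w i` to `lam i`, whose
    -- sum is `n`. This gives `L * n` instead of `L ^ 2` times the sum of `w`.
    have hwm2 : w i * m i ^ 2 ≤ L * lam i := by
      rw [← hwm]; nlinarith [mul_nonneg hw0 (hm0 i), hmL i]
    have hb2 := sq_nonneg β
    calc w i * ‖m i • (trueGrad f D W (Matrix.diagonal m) α ξ θ₀ (t + 1) ω i
          - trueGrad f D W (Matrix.diagonal m) α ξ θ₀ t ω i)‖ ^ 2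
        = w i * m i ^ 2 * ‖trueGrad f D W (Matrix.diagonal m) α ξ θ₀ (t + 1) ω i
          - trueGrad f D W (Matrix.diagonal m) α ξ θ₀ t ω i‖ ^ 2 := by
          rw [norm_smul, mul_pow, Real.norm_eq_abs, sq_abs]; ring
      _ ≤ w i * m i ^ 2 * (β ^ 2 * (4 * ‖Θ' i - wAvg w Θ'‖ ^ 2 + 4 * ‖Θ i - wAvg w Θ‖ ^ 2
          + 2 * α ^ 2 * ‖g‖ ^ 2)) := by
          refine mul_le_mul_of_nonneg_left (h1.trans ?_) (mul_nonneg hw0 (sq_nonneg _))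
          exact mul_le_mul_of_nonneg_left h2 hb2
      _ = β ^ 2 * (m i ^ 2 * (4 * (w i * ‖Θ' i - wAvg w Θ'‖ ^ 2)
          + 4 * (w i * ‖Θ i - wAvg w Θ‖ ^ 2)) + w i * m i ^ 2 * (2 * α ^ 2 * ‖g‖ ^ 2)) := by ring
      _ ≤ β ^ 2 * (L ^ 2 * (4 * (w i * ‖Θ' i - wAvg w Θ'‖ ^ 2)
          + 4 * (w i * ‖Θ i - wAvg w Θ‖ ^ 2)) + L * lam i * (2 * α ^ 2 * ‖g‖ ^ 2)) := by
          gcongr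
      _ = _ := by ring
  refine (Finset.sum_le_sum fun i _ => hpt i).trans (le_of_eq ?_)
  rw [← Finset.mul_sum, Finset.sum_add_distrib, Finset.sum_add_distrib, ← Finset.mul_sum,
    ← Finset.mul_sum, ← Finset.mul_sum]
  ring

lemma measurable_wAvg_trueGrad (hsm : IsSmooth f D β) (hor : IsOracle f D υ) (lam : Fin n → ℝ)
    (t : ℕ) : Measurable[sampleSigma ξ (before n t)]
      fun ω => wAvg lam (trueGrad f D W Gm α ξ θ₀ t ω) :=
  measurable_wAvg fun i => (hsm.continuous_gradient i).measurable.comp ((measurable_run hor t).1 i)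

lemma measurable_gradient_globalLoss (hsm : IsSmooth f D β) (hor : IsOracle f D υ)
    (lam w : Fin n → ℝ) (t : ℕ) : Measurable[sampleSigma ξ (before n t)]
      fun ω => gradient (globalLoss lam f D) (wAvg w (run f W Gm α ξ θ₀ t ω).1) := by
  simp only [hsm.gradient_globalLoss]
  exact measurable_wAvg fun i => (hsm.continuous_gradient i).measurable.comp
    (measurable_wAvg fun j => (measurable_run hor t).1 j)

variable [MeasurableSpace Ω] {P : Measure Ω}

/-- The loss lies between its minimum and the quadratic upper bound given by the descent lemma at
the minimizer; the latter is integrable for square-integrable `θ`. -/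
lemma integrable_globalLoss [NeZero n] [IsFiniteMeasure P] (hsm : IsSmooth f D β) (hβ : 0 ≤ β) (hlam : ∀ i, 0 ≤ lam i)
    (hlam_sum : ∑ i, lam i = n) {θstar : Param d}
    (hstar : ∀ θ, globalLoss lam f D θstar ≤ globalLoss lam f D θ) {θ : Ω → Param d}
    (hθ : MemLp θ 2 P) : Integrable (fun ω => globalLoss lam f D (θ ω)) P := by
  have hdiff : MemLp (fun ω => θ ω - θstar) 2 P := hθ.sub (memLp_const θstar)
  have i1 := (integrable_inner_of_memLp (memLp_const (gradient (globalLoss lam f D) θstar))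
    hdiff).add ((integrable_normSq hdiff).const_mul (β / 2))
  have i2 := i1.norm.add (integrable_const ‖globalLoss lam f D θstar‖)
  refine i2.mono (hsm.differentiable_globalLoss.continuous.comp_aestronglyMeasurable hθ.1)
    (Filter.Eventually.of_forall fun ω => ?_)
  have h1 := le_add_inner_gradient_add (β := β) hsm.differentiable_globalLoss
    (hsm.lipschitz_gradient_globalLoss hβ hlam hlam_sum) θstar (θ ω - θstar)
  rw [add_sub_cancel] at h1
  have h2 := hstar (θ ω)
  refine le_trans ?_ (le_abs_self _)
  simp only [Pi.add_apply, Real.norm_eq_abs]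
  rw [abs_le]
  constructor
  · have := neg_abs_le (globalLoss lam f D θstar)
    have := abs_nonneg (inner ℝ (gradient (globalLoss lam f D) θstar) (θ ω - θstar)
      + β / 2 * ‖θ ω - θstar‖ ^ 2)
    linarith
  · have := le_abs_self (globalLoss lam f D θstar)
    have := le_abs_self (inner ℝ (gradient (globalLoss lam f D) θstar) (θ ω - θstar)
      + β / 2 * ‖θ ω - θstar‖ ^ 2)
    linarith

variable [IsProbabilityMeasure P] [∀ i, IsProbabilityMeasure (D i)]

lemma memLp_wAvg_run (hξ : IsSampling P D ξ) (hsm : IsSmooth f D β) (hor : IsOracle f D υ)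
    (w : Fin n → ℝ) (t : ℕ) : MemLp (fun ω => wAvg w (run f W Gm α ξ θ₀ t ω).1) 2 P :=
  memLp_wAvg (memLp_run hξ hsm hor t).1

lemma memLp_wAvg_trueGrad (hξ : IsSampling P D ξ) (hsm : IsSmooth f D β) (hor : IsOracle f D υ)
    (w : Fin n → ℝ) (t : ℕ) : MemLp (fun ω => wAvg w (trueGrad f D W Gm α ξ θ₀ t ω)) 2 P :=
  memLp_wAvg (memLp_trueGrad hξ hsm hor t)

lemma memLp_wAvg_noise (hξ : IsSampling P D ξ) (hsm : IsSmooth f D β) (hor : IsOracle f D υ)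
    (w : Fin n → ℝ) (t : ℕ) : MemLp (fun ω => wAvg w (noise f D W Gm α ξ θ₀ t ω)) 2 P :=
  memLp_wAvg (memLp_noise hξ hsm hor t)

lemma memLp_gradient_globalLoss (hξ : IsSampling P D ξ) (hsm : IsSmooth f D β)
    (hor : IsOracle f D υ) (lam w : Fin n → ℝ) (t : ℕ) :
    MemLp (fun ω => gradient (globalLoss lam f D) (wAvg w (run f W Gm α ξ θ₀ t ω).1)) 2 P := by
  simp only [hsm.gradient_globalLoss]
  exact memLp_wAvg fun i => memLp_comp_gradient hsm i (memLp_wAvg_run hξ hsm hor w t)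

/-- The cross term vanishes because the current noise is uncorrelated with the current true
gradients. -/
lemma integral_wAvg_gradStack_sq_le (hξ : IsSampling P D ξ) (hsm : IsSmooth f D β)
    (hor : IsOracle f D υ) (lam : Fin n → ℝ) (t : ℕ) :
    ∫ ω, ‖wAvg lam (gradStack f W Gm α ξ θ₀ t ω)‖ ^ 2 ∂P
      ≤ ∫ ω, ‖wAvg lam (trueGrad f D W Gm α ξ θ₀ t ω)‖ ^ 2 ∂P + cLam lam * υ ^ 2 := by
  have hg := memLp_wAvg_trueGrad (W := W) (Gm := Gm) (α := α) (θ₀ := θ₀) hξ hsm hor lam t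
  have hs := memLp_wAvg_noise (W := W) (Gm := Gm) (α := α) (θ₀ := θ₀) hξ hsm hor lam t
  have h1 := integral_inner_wAvg_noise (lam := lam) (W := W) (Gm := Gm) (α := α) (θ₀ := θ₀)
    hξ hsm hor t (measurable_wAvg_trueGrad hsm hor lam t) hg
  have h2 := integral_wAvg_noise_sq_le (lam := lam) (W := W) (Gm := Gm) (α := α) (θ₀ := θ₀)
    hξ hsm hor t
  have i1 := integrable_normSq hg
  have i2 := (integrable_inner_of_memLp hg hs).const_mul 2
  have i3 := integrable_normSq hs
  simp only [gradStack_eq (D := D), wAvg_add, norm_add_sq_real]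
  rw [integral_add (i1.fun_add i2) i3, integral_add i1 i2, integral_const_mul, h1]
  linarith

lemma integral_inner_gradient_gradStack (hξ : IsSampling P D ξ) (hsm : IsSmooth f D β)
    (hor : IsOracle f D υ) (lam w : Fin n → ℝ) (t : ℕ) :
    ∫ ω, inner ℝ (gradient (globalLoss lam f D) (wAvg w (run f W Gm α ξ θ₀ t ω).1))
        (wAvg lam (gradStack f W Gm α ξ θ₀ t ω)) ∂P
      = ∫ ω, inner ℝ (gradient (globalLoss lam f D) (wAvg w (run f W Gm α ξ θ₀ t ω).1))
        (wAvg lam (trueGrad f D W Gm α ξ θ₀ t ω)) ∂P := by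
  have hF := memLp_gradient_globalLoss (W := W) (Gm := Gm) (α := α) (θ₀ := θ₀) hξ hsm hor lam w t
  simp only [gradStack_eq (D := D), wAvg_add, inner_add_right]
  rw [integral_add (integrable_inner_of_memLp hF (memLp_wAvg_trueGrad hξ hsm hor lam t))
    (integrable_inner_of_memLp hF (memLp_wAvg_noise hξ hsm hor lam t)),
    integral_inner_wAvg_noise hξ hsm hor t (measurable_gradient_globalLoss hsm hor lam w t) hF,
    add_zero]

variable [NeZero n]

/-- The expected decrease of the global loss in one iteration. -/
lemma integral_globalLoss_succ_le (hξ : IsSampling P D ξ) (hsm : IsSmooth f D β)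
    (hor : IsOracle f D υ) (hβ : 0 ≤ β) (hα : 0 ≤ α) (hw : ∀ i, 0 < w i)
    (hwm : ∀ i, w i * m i = lam i) (hm0 : ∀ i, 0 ≤ m i) (hmL : ∀ i, m i ≤ L)
    (hlam_sum : ∑ i, lam i = n) (hW : IsMixing G w W) {θstar : Param d}
    (hstar : ∀ θ, globalLoss lam f D θstar ≤ globalLoss lam f D θ) (t : ℕ) :
    ∫ ω, globalLoss lam f D (wAvg w (run f W (Matrix.diagonal m) α ξ θ₀ (t + 1) ω).1) ∂P
      ≤ ∫ ω, globalLoss lam f D (wAvg w (run f W (Matrix.diagonal m) α ξ θ₀ t ω).1) ∂P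
        - α / 2 * ∫ ω, ‖gradient (globalLoss lam f D)
            (wAvg w (run f W (Matrix.diagonal m) α ξ θ₀ t ω).1)‖ ^ 2 ∂P
        - α / 2 * (1 - α * β) *
          ∫ ω, ‖wAvg lam (trueGrad f D W (Matrix.diagonal m) α ξ θ₀ t ω)‖ ^ 2 ∂P
        + α / 2 * (L * β ^ 2 / n * ∫ ω, ‖errΘ f w m W α ξ θ₀ t ω‖ ^ 2 ∂P)
        + α / 2 * (α * β * (cLam lam * υ ^ 2)) := by
  have hlam : ∀ i, 0 ≤ lam i := fun i => by rw [← hwm]; exact mul_nonneg (hw i).le (hm0 i)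
  set F := globalLoss lam f D
  set x : Ω → Param d := fun ω => wAvg w (run f W (Matrix.diagonal m) α ξ θ₀ t ω).1 with hx
  set g : Ω → Param d := fun ω => wAvg lam (gradStack f W (Matrix.diagonal m) α ξ θ₀ t ω) with hg
  set h : Ω → Param d := fun ω => wAvg lam (trueGrad f D W (Matrix.diagonal m) α ξ θ₀ t ω) with hh
  have hstep : ∀ ω, wAvg w (run f W (Matrix.diagonal m) α ξ θ₀ (t + 1) ω).1
      = x ω + -(α • g ω) := fun ω => by
    rw [wAvg_run_fst_succ hW hwm, sub_eq_add_neg]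
  have hxL : MemLp x 2 P := memLp_wAvg_run hξ hsm hor w t
  have hhL : MemLp h 2 P := memLp_wAvg_trueGrad hξ hsm hor lam t
  have hgL : MemLp g 2 P := by
    simp only [hg, gradStack_eq (D := D), wAvg_add]
    exact hhL.add (memLp_wAvg_noise hξ hsm hor lam t)
  have hFL : MemLp (fun ω => gradient F (x ω)) 2 P := memLp_gradient_globalLoss hξ hsm hor lam w t
  have heL : MemLp (errΘ f w m W α ξ θ₀ t) 2 P :=
    memLp_wEmbed (memLp_act (memLp_run hξ hsm hor t).1 _)
  have hFx : Integrable (fun ω => F (x ω)) P :=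
    integrable_globalLoss hsm hβ hlam hlam_sum hstar hxL
  have hFx' : Integrable (fun ω =>
      F (wAvg w (run f W (Matrix.diagonal m) α ξ θ₀ (t + 1) ω).1)) P :=
    integrable_globalLoss hsm hβ hlam hlam_sum hstar (memLp_wAvg_run hξ hsm hor w (t + 1))
  have i1 := (integrable_inner_of_memLp hFL hgL).const_mul α
  have i2 := (integrable_normSq hgL).const_mul (β / 2 * α ^ 2)
  have i0 : Integrable (fun ω => F (x ω) - α * inner ℝ (gradient F (x ω)) (g ω)) P := hFx.sub i1
  have hdesc : ∫ ω, F (wAvg w (run f W (Matrix.diagonal m) α ξ θ₀ (t + 1) ω).1) ∂P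
      ≤ ∫ ω, F (x ω) ∂P - α * ∫ ω, inner ℝ (gradient F (x ω)) (g ω) ∂P
        + β / 2 * α ^ 2 * ∫ ω, ‖g ω‖ ^ 2 ∂P := by
    rw [← integral_const_mul, ← integral_const_mul, ← integral_sub hFx i1,
      ← integral_add i0 i2]
    refine integral_mono hFx' ((hFx.sub i1).add i2) fun ω => ?_
    have h1 := le_add_inner_gradient_add (β := β) hsm.differentiable_globalLoss
      (hsm.lipschitz_gradient_globalLoss hβ hlam hlam_sum) (x ω) (-(α • g ω))
    rw [inner_neg_right, inner_smul_right, norm_neg, norm_smul, mul_pow, Real.norm_eq_abs,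
      sq_abs] at h1
    simp only [hstep]
    linarith
  have hcross : ∫ ω, inner ℝ (gradient F (x ω)) (g ω) ∂P
      = ∫ ω, inner ℝ (gradient F (x ω)) (h ω) ∂P :=
    integral_inner_gradient_gradStack hξ hsm hor lam w t
  have hgsq : ∫ ω, ‖g ω‖ ^ 2 ∂P ≤ ∫ ω, ‖h ω‖ ^ 2 ∂P + cLam lam * υ ^ 2 :=
    integral_wAvg_gradStack_sq_le hξ hsm hor lam t
  -- Polarization: twice the inner product is the sum of the squared norms minus the squared
  -- distance, and the distance is a consensus error since `lam i ≤ L * w i`.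
  have hpol : ∫ ω, ‖gradient F (x ω)‖ ^ 2 ∂P + ∫ ω, ‖h ω‖ ^ 2 ∂P
      - L * β ^ 2 / n * ∫ ω, ‖errΘ f w m W α ξ θ₀ t ω‖ ^ 2 ∂P
      ≤ 2 * ∫ ω, inner ℝ (gradient F (x ω)) (h ω) ∂P := by
    rw [← integral_const_mul, ← integral_const_mul,
      ← integral_add (integrable_normSq hFL) (integrable_normSq hhL),
      ← integral_sub ((integrable_normSq hFL).fun_add (integrable_normSq hhL))
        ((integrable_normSq heL).const_mul _)]
    refine integral_mono (((integrable_normSq hFL).fun_add (integrable_normSq hhL)).sub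
        ((integrable_normSq heL).const_mul _)) ((integrable_inner_of_memLp hFL hhL).const_mul 2)
        fun ω => ?_
    have h1 := hsm.norm_sq_gradient_globalLoss_sub_le hlam hlam_sum (x ω)
      (run f W (Matrix.diagonal m) α ξ θ₀ t ω).1
    have h2 := norm_sub_sq_real (gradient F (x ω)) (h ω)
    have h3 : (1 / (n : ℝ)) * ∑ i, lam i *
        ‖(run f W (Matrix.diagonal m) α ξ θ₀ t ω).1 i - x ω‖ ^ 2
        ≤ (1 / (n : ℝ)) * (L * ‖errΘ f w m W α ξ θ₀ t ω‖ ^ 2) := by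
      rw [norm_errΘ_sq hw, Finset.mul_sum (a := L)]
      refine mul_le_mul_of_nonneg_left (Finset.sum_le_sum fun i _ => ?_)
        (by positivity : (0 : ℝ) ≤ 1 / n)
      rw [← mul_assoc, ← hwm, mul_comm L]
      exact mul_le_mul_of_nonneg_right (mul_le_mul_of_nonneg_left (hmL i) (hw i).le) (sq_nonneg _)
    have h4 := h1.trans (mul_le_mul_of_nonneg_left h3 (sq_nonneg β))
    have h5 : β ^ 2 * (1 / (n : ℝ) * (L * ‖errΘ f w m W α ξ θ₀ t ω‖ ^ 2))
        = L * β ^ 2 / n * ‖errΘ f w m W α ξ θ₀ t ω‖ ^ 2 := by ring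
    have h6 : ‖gradient F (x ω) - h ω‖ ^ 2
        ≤ L * β ^ 2 / n * ‖errΘ f w m W α ξ θ₀ t ω‖ ^ 2 := h5 ▸ h4
    simp only
    linarith
  rw [hcross] at hdesc
  have h7 := mul_le_mul_of_nonneg_left hgsq (by positivity : 0 ≤ β / 2 * α ^ 2)
  have h8 := mul_le_mul_of_nonneg_left hpol (by positivity : 0 ≤ α / 2)
  linarith

/-- Summing the expected decreases of the global loss. -/
lemma sum_gradient_sq_le (hξ : IsSampling P D ξ) (hsm : IsSmooth f D β)
    (hor : IsOracle f D υ) (hβ : 0 ≤ β) (hα : 0 < α) (hw : ∀ i, 0 < w i)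
    (hwm : ∀ i, w i * m i = lam i) (hm0 : ∀ i, 0 ≤ m i) (hmL : ∀ i, m i ≤ L)
    (hw_sum : ∑ i, w i = n) (hlam_sum : ∑ i, lam i = n) (hW : IsMixing G w W) {θstar : Param d}
    (hstar : ∀ θ, globalLoss lam f D θstar ≤ globalLoss lam f D θ) (T : ℕ) :
    ∑ t ∈ Finset.range T, ∫ ω, ‖gradient (globalLoss lam f D)
            (wAvg w (run f W (Matrix.diagonal m) α ξ θ₀ t ω).1)‖ ^ 2 ∂P
        + (1 - α * β) * ∑ t ∈ Finset.range T,
          ∫ ω, ‖wAvg lam (trueGrad f D W (Matrix.diagonal m) α ξ θ₀ t ω)‖ ^ 2 ∂P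
      ≤ 2 * (globalLoss lam f D θ₀ - globalLoss lam f D θstar) / α
        + L * β ^ 2 / n * ∑ t ∈ Finset.range T, ∫ ω, ‖errΘ f w m W α ξ θ₀ t ω‖ ^ 2 ∂P
        + T * (α * β * (cLam lam * υ ^ 2)) := by
  have hlam : ∀ i, 0 ≤ lam i := fun i => by rw [← hwm]; exact mul_nonneg (hw i).le (hm0 i)
  -- The loss at the final iterate is kept in the induction so that the decreases telescope; it is
  -- replaced by the minimum afterwards.
  have key : ∑ t ∈ Finset.range T, ∫ ω, ‖gradient (globalLoss lam f D)
            (wAvg w (run f W (Matrix.diagonal m) α ξ θ₀ t ω).1)‖ ^ 2 ∂P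
        + (1 - α * β) * ∑ t ∈ Finset.range T,
          ∫ ω, ‖wAvg lam (trueGrad f D W (Matrix.diagonal m) α ξ θ₀ t ω)‖ ^ 2 ∂P
      ≤ 2 / α * (globalLoss lam f D θ₀ - ∫ ω, globalLoss lam f D
          (wAvg w (run f W (Matrix.diagonal m) α ξ θ₀ T ω).1) ∂P)
        + L * β ^ 2 / n * ∑ t ∈ Finset.range T, ∫ ω, ‖errΘ f w m W α ξ θ₀ t ω‖ ^ 2 ∂P
        + T * (α * β * (cLam lam * υ ^ 2)) := by
    induction T with
    | zero =>
      have h0 : ∀ ω, wAvg w (run f W (Matrix.diagonal m) α ξ θ₀ 0 ω).1 = θ₀ :=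
        fun ω => wAvg_const hw_sum θ₀
      simp [h0]
    | succ T ih =>
      have h1 := mul_le_mul_of_nonneg_left (integral_globalLoss_succ_le (θ₀ := θ₀) hξ hsm hor hβ
        hα.le hw hwm hm0 hmL hlam_sum hW hstar T) (by positivity : 0 ≤ 2 / α)
      have h2 : ∀ a b c d e : ℝ, 2 / α * (a - α / 2 * b - α / 2 * (1 - α * β) * c + α / 2 * d
          + α / 2 * e) = 2 / α * a - b - (1 - α * β) * c + d + e := by
        intro a b c d e; field_simp
      rw [h2] at h1
      simp only [Finset.sum_range_succ, Nat.cast_add, Nat.cast_one]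
      linarith
  have hlow : globalLoss lam f D θstar ≤ ∫ ω, globalLoss lam f D
      (wAvg w (run f W (Matrix.diagonal m) α ξ θ₀ T ω).1) ∂P := by
    have := integral_mono (integrable_const (globalLoss lam f D θstar))
      (integrable_globalLoss hsm hβ hlam hlam_sum hstar
        (memLp_wAvg_run (W := W) (Gm := Matrix.diagonal m) (α := α) (θ₀ := θ₀) hξ hsm hor w T))
      fun ω => hstar _
    simpa using this
  have h3 := mul_le_mul_of_nonneg_left hlow (by positivity : 0 ≤ 2 / α)
  have h4 : 2 * (globalLoss lam f D θ₀ - globalLoss lam f D θstar) / α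
      = 2 / α * globalLoss lam f D θ₀ - 2 / α * globalLoss lam f D θstar := by ring
  rw [h4]
  linarith

/-- The accumulated consensus error. -/
lemma sum_errΘ_sq_le (hξ : IsSampling P D ξ) (hsm : IsSmooth f D β)
    (hor : IsOracle f D υ) (hG : G.Connected) (hw : ∀ i, 0 < w i)
    (hwm : ∀ i, w i * m i = lam i) (hm0 : ∀ i, 0 ≤ m i) (hmL : ∀ i, m i ≤ L)
    (hw_sum : ∑ i, w i = n) (hlam_sum : ∑ i, lam i = n) (hW : IsMixing G w W) {ρ : ℝ}
    (hρ : ρ = specRad (W - lamMat w)) (N : ℕ) :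
    ∑ t ∈ Finset.range (N + 1), ∫ ω, ‖errΘ f w m W α ξ θ₀ t ω‖ ^ 2 ∂P
      ≤ 3 * (ρ ^ 2 * constA ρ) * ∫ ω, ‖errY f w m W α ξ θ₀ 0 ω‖ ^ 2 ∂P
        + 12 * α ^ 2 * (ρ ^ 2 * constA ρ) * (n * L * υ ^ 2) * (N + 1)
        + 3 * α ^ 2 * (ρ / (1 - ρ) ^ 2) ^ 2 * (β ^ 2 *
          (8 * L ^ 2 * ∑ t ∈ Finset.range (N + 1), ∫ ω, ‖errΘ f w m W α ξ θ₀ t ω‖ ^ 2 ∂P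
          + 2 * L * n * α ^ 2 * (∑ t ∈ Finset.range (N + 1),
            ∫ ω, ‖wAvg lam (trueGrad f D W (Matrix.diagonal m) α ξ θ₀ t ω)‖ ^ 2 ∂P
            + (N + 1) * (cLam lam * υ ^ 2)))) := by
  have hn : (0 : ℝ) < n := by exact_mod_cast NeZero.pos n
  have hL0 : 0 ≤ L := (hm0 0).trans (hmL 0)
  have hρ0 : 0 ≤ ρ := hρ ▸ specRad_nonneg _
  have hρ1 : ρ < 1 := hρ ▸ hW.specRad_lt_one hG hw hw_sum
  have heL : ∀ t, MemLp (errΘ f w m W α ξ θ₀ t) 2 P := fun t =>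
    memLp_wEmbed (memLp_act (memLp_run hξ hsm hor t).1 _)
  have hpL : ∀ t, MemLp (fun ω => wEmbed w (fun i => m i •
      (trueGrad f D W (Matrix.diagonal m) α ξ θ₀ (t + 1) ω i
        - trueGrad f D W (Matrix.diagonal m) α ξ θ₀ t ω i))) 2 P := fun t =>
    memLp_wEmbed fun i => ((memLp_trueGrad hξ hsm hor (t + 1) i).sub
      (memLp_trueGrad hξ hsm hor t i)).const_smul (m i)
  have hsL : ∀ t, MemLp (fun ω => wEmbed w (fun i => m i •
      noise f D W (Matrix.diagonal m) α ξ θ₀ t ω i)) 2 P := fun t =>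
    memLp_wEmbed fun i => (memLp_noise hξ hsm hor t i).const_smul (m i)
  have hgL : ∀ t, MemLp (fun ω =>
      wAvg lam (gradStack f W (Matrix.diagonal m) α ξ θ₀ t ω)) 2 P := fun t => by
    simp only [gradStack_eq (D := D), wAvg_add]
    exact (memLp_wAvg_trueGrad hξ hsm hor lam t).add (memLp_wAvg_noise hξ hsm hor lam t)
  have hσ : ∀ t, ∫ ω, ‖wEmbed w (fun i => m i •
      noise f D W (Matrix.diagonal m) α ξ θ₀ t ω i)‖ ^ 2 ∂P ≤ n * L * υ ^ 2 := by
    intro t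
    simp only [norm_wEmbed_sq (fun i => (hw i).le), wFrobSq, norm_smul, mul_pow,
      Real.norm_eq_abs, sq_abs]
    rw [integral_finsetSum _ fun i _ => ((integrable_normSq
      (memLp_noise hξ hsm hor t i)).const_mul _).const_mul _, ← hlam_sum, Finset.sum_mul,
      Finset.sum_mul]
    refine Finset.sum_le_sum fun i _ => ?_
    rw [integral_const_mul, integral_const_mul, ← mul_assoc, sq (m i), ← mul_assoc, hwm]
    have hlam0 : 0 ≤ lam i := by rw [← hwm]; exact mul_nonneg (hw i).le (hm0 i)
    exact mul_le_mul (mul_le_mul_of_nonneg_left (hmL i) hlam0)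
      (integral_noise_sq_le hξ hsm hor t i) (integral_nonneg fun ω => sq_nonneg _)
      (mul_nonneg hlam0 hL0)
  have hmain := consensus_bound (x := errΘ f w m W α ξ θ₀) (y := errY f w m W α ξ θ₀)
    (K := mixOp w W) (Pr := projOp w) (α := α) (P := P)
    (fun v => hρ ▸ hW.norm_mixOp_le hw v) hρ0 hρ1 (hW.mixOp_projOp hw hw_sum)
    (errΘ_zero hw_sum) (errΘ_succ hW hw hw_sum)
    (fun t ω => by
      rw [errY_succ hW hw hw_sum, ← wEmbed_add, ← wEmbed_sub]
      congr 4
      rw [gradStack_eq (D := D), gradStack_eq (D := D), act_diagonal]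
      funext i
      simp only [Pi.add_apply, Pi.sub_apply, ← smul_add, ← smul_sub]
      congr 1
      abel)
    (memLp_wEmbed fun i => (memLp_act (memLp_run hξ hsm hor 0).2 _ i).const_smul α)
    hpL hsL hσ (fun A B k l hkl => integral_inner_wEmbed_noise hξ hsm hor A B hkl) N
  refine hmain.trans ?_
  gcongr
  -- What remains is the perturbation, the change of the true gradients, which brings the consensus
  -- errors themselves back into the bound.
  have hstep : ∀ t, ∫ ω, ‖wEmbed w (fun i => m i •
      (trueGrad f D W (Matrix.diagonal m) α ξ θ₀ (t + 1) ω i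
        - trueGrad f D W (Matrix.diagonal m) α ξ θ₀ t ω i))‖ ^ 2 ∂P
      ≤ β ^ 2 * (4 * L ^ 2 * (∫ ω, ‖errΘ f w m W α ξ θ₀ (t + 1) ω‖ ^ 2 ∂P
          + ∫ ω, ‖errΘ f w m W α ξ θ₀ t ω‖ ^ 2 ∂P)
        + 2 * L * n * α ^ 2 *
          (∫ ω, ‖wAvg lam (trueGrad f D W (Matrix.diagonal m) α ξ θ₀ t ω)‖ ^ 2 ∂P
            + cLam lam * υ ^ 2)) := by
    intro t
    have i1 := ((integrable_normSq (heL (t + 1))).fun_add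
      (integrable_normSq (heL t))).const_mul (4 * L ^ 2)
    have i2 := (integrable_normSq (hgL t)).const_mul (2 * L * n * α ^ 2)
    have h1 := integral_mono (integrable_normSq (hpL t)) ((i1.fun_add i2).const_mul (β ^ 2))
      fun ω => norm_sq_grad_change_le hsm hw hwm hm0 hmL hlam_sum hW t ω
    refine h1.trans ?_
    rw [integral_const_mul]
    refine mul_le_mul_of_nonneg_left ?_ (sq_nonneg β)
    rw [integral_add i1 i2, integral_const_mul, integral_const_mul]
    rw [integral_add (integrable_normSq (heL (t + 1))) (integrable_normSq (heL t))]
    gcongr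
    exact integral_wAvg_gradStack_sq_le hξ hsm hor lam t
  refine (Finset.sum_le_sum fun t _ => hstep t).trans ?_
  rw [← Finset.mul_sum, Finset.sum_add_distrib, ← Finset.mul_sum, ← Finset.mul_sum,
    Finset.sum_add_distrib, Finset.sum_add_distrib, Finset.sum_const, Finset.card_range,
    nsmul_eq_mul]
  refine mul_le_mul_of_nonneg_left ?_ (sq_nonneg β)
  have hc : 0 ≤ cLam lam * υ ^ 2 := mul_nonneg
    (mul_nonneg (by positivity) (Finset.sum_nonneg fun i _ => sq_nonneg _)) (sq_nonneg υ)
  -- The shifted and the unshifted sum of consensus errors are both at most the full sum, which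
  -- turns 4 into 8.
  have h1 : ∑ t ∈ Finset.range N, ∫ ω, ‖errΘ f w m W α ξ θ₀ (t + 1) ω‖ ^ 2 ∂P
      ≤ ∑ t ∈ Finset.range (N + 1), ∫ ω, ‖errΘ f w m W α ξ θ₀ t ω‖ ^ 2 ∂P := by
    rw [Finset.sum_range_succ' _ N]
    exact le_add_of_nonneg_right (integral_nonneg fun ω => sq_nonneg _)
  have h2 : ∑ t ∈ Finset.range N, ∫ ω, ‖errΘ f w m W α ξ θ₀ t ω‖ ^ 2 ∂P
      ≤ ∑ t ∈ Finset.range (N + 1), ∫ ω, ‖errΘ f w m W α ξ θ₀ t ω‖ ^ 2 ∂P := by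
    rw [Finset.sum_range_succ _ N]
    exact le_add_of_nonneg_right (integral_nonneg fun ω => sq_nonneg _)
  have h3 : ∑ t ∈ Finset.range N,
        ∫ ω, ‖wAvg lam (trueGrad f D W (Matrix.diagonal m) α ξ θ₀ t ω)‖ ^ 2 ∂P
      + N * (cLam lam * υ ^ 2) ≤ ∑ t ∈ Finset.range (N + 1),
        ∫ ω, ‖wAvg lam (trueGrad f D W (Matrix.diagonal m) α ξ θ₀ t ω)‖ ^ 2 ∂P
      + (N + 1) * (cLam lam * υ ^ 2) := by
    rw [Finset.sum_range_succ _ N]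
    have : 0 ≤ ∫ ω, ‖wAvg lam (trueGrad f D W (Matrix.diagonal m) α ξ θ₀ N ω)‖ ^ 2 ∂P :=
      integral_nonneg fun ω => sq_nonneg _
    linarith
  have h4 := mul_le_mul_of_nonneg_left h3 (by positivity : 0 ≤ 2 * L * n * α ^ 2)
  have h5 := mul_le_mul_of_nonneg_left (add_le_add h1 h2) (by positivity : 0 ≤ 4 * L ^ 2)
  linarith

end Estimates

end

section

/-! ### Constants -/

/-- The denominator is at most 1. The bound is used to turn the step-size condition into `α * β ≤ 1
/ 2`. -/
lemma constB_ge_two {ρ : ℝ} (h0 : 0 ≤ ρ) (h1 : ρ < 1) : 2 ≤ constB ρ := by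
  have h2 : 0 < 1 - ρ := by linarith
  have h3 : 0 < 1 - ρ ^ 2 := by nlinarith
  have h4 : (1 - ρ ^ 2) ^ 3 * (1 - ρ) ≤ 1 :=
    mul_le_one₀ (pow_le_one₀ h3.le (by nlinarith)) h2.le (by linarith)
  rw [constB, le_div_iff₀ (by positivity)]
  have : 0 ≤ ρ ^ 4 := by positivity
  linarith

lemma sq_resp_gain_le_constB {ρ : ℝ} (h0 : 0 ≤ ρ) (h1 : ρ < 1) :
    (ρ / (1 - ρ) ^ 2) ^ 2 ≤ constB ρ := by
  have h2 : 0 < 1 - ρ := by linarith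
  have h3 : (1 - ρ ^ 2) ^ 3 * (1 - ρ) = (1 - ρ) ^ 4 * (1 + ρ) ^ 3 := by ring
  have h4 : ρ ^ 2 * (1 + ρ) ^ 3 ≤ 2 * (1 + 3 * ρ ^ 4) := by
    -- This product is exactly the right side of `h4` minus its left side.
    have : 0 ≤ (1 - ρ) * (2 + 2 * ρ + ρ ^ 2 * (1 - ρ) ^ 2) := by positivity
    nlinarith
  rw [constB, h3, div_pow, ← pow_mul, div_le_div_iff₀ (by positivity) (by positivity)]
  calc ρ ^ 2 * ((1 - ρ) ^ 4 * (1 + ρ) ^ 3) = (1 - ρ) ^ 4 * (ρ ^ 2 * (1 + ρ) ^ 3) := by ring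
    _ ≤ (1 - ρ) ^ 4 * (2 * (1 + 3 * ρ ^ 4)) := by gcongr
    _ = _ := by ring

/-- Relaxes the coefficient of the initial tracker error to the stated one, using `ρ ^ 4 ≤ ρ ^ 2`.
-/
lemma three_mul_sq_mul_constA_le {ρ : ℝ} (h0 : 0 ≤ ρ) (h1 : ρ < 1) :
    3 * (ρ ^ 2 * constA ρ) ≤ 6 * (3 * (1 - ρ ^ 2) ^ 2 + ρ ^ 2) / (1 - ρ ^ 2) ^ 3 := by
  have h3 : 0 < 1 - ρ ^ 2 := by nlinarith
  have h4 : 0 ≤ ρ ^ 2 * (1 - ρ ^ 2) := by positivity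
  rw [constA, ← mul_div_assoc, ← mul_div_assoc]
  refine div_le_div_of_nonneg_right ?_ (by positivity)
  nlinarith [sq_nonneg (1 - ρ ^ 2)]

lemma step_size_sq_lt {L α β B : ℝ} (hL : 0 < L) (hα : 0 < α) (hβ : 0 < β) (hB : 0 < B)
    (h : α < 1 / (L * β) * √(1 / (62 * B))) : L ^ 2 * α ^ 2 * β ^ 2 * B < 1 / 62 := by
  have hLβ : 0 < L * β := mul_pos hL hβ
  rw [one_div_mul_eq_div, lt_div_iff₀ hLβ, Real.lt_sqrt (by positivity),
    lt_div_iff₀ (by positivity)] at h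
  rw [lt_div_iff₀ (by norm_num)]
  linarith

/-- The coefficients `C₁` and `C₂` are positive for `x < 1 / 62`. -/
lemma rate_coefficients_pos {x : ℝ} (hx : x < 1 / 62) :
    0 < 1 - 60 * x ∧ 0 < 1 - 2 * x / (1 - 60 * x) := by
  have h1 : 0 < 1 - 60 * x := by linarith
  refine ⟨h1, ?_⟩
  rw [sub_pos, div_lt_one h1]
  linarith

lemma rate_regroup {Δ κ E L α β υ c q n T A B C1 C2 p : ℝ} (hn : n ≠ 0) (hT : T ≠ 0)
    (hC1 : C1 ≠ 0) (hC2 : C2 ≠ 0) (hα : α ≠ 0) (hp : p ≠ 0) :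
    1 / C2 * (1 / T * (2 * Δ / α + T * (α * β * (c * υ ^ 2))
        + (κ * (6 * q / p * β ^ 2 / n) * E
          + L ^ 2 * (18 * α ^ 2 * β ^ 2 * υ ^ 2 * (A + 3 / 2 * c * α ^ 2 * β ^ 2 * B)) * T) / C1))
      = 1 / C2 * (2 * Δ / (α * T)) + 1 / C2 * (α * c * β * υ ^ 2)
        + κ / (C1 * C2) * (6 * q * β ^ 2 / (p * n * T)) * E
        + L ^ 2 / (C1 * C2) * (18 * α ^ 2 * β ^ 2 * υ ^ 2
          * (A + 3 / 2 * c * α ^ 2 * β ^ 2 * B)) := by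
  field_simp
  ring

set_option maxHeartbeats 400000 in
/-- Combination of the descent estimate and the consensus estimate. -/
lemma rate_of_estimates {a b S e E Δ κ L α β υ c ρ n T R : ℝ} (hn : 0 < n) (hT : 0 < T)
    (hL : 1 ≤ L) (hα : 0 < α) (hβ : 0 < β) (hρ0 : 0 ≤ ρ) (hρ1 : ρ < 1) (hc : 0 ≤ c)
    (hb : 0 ≤ b) (hS0 : 0 ≤ S) (hΔ : 0 ≤ Δ) (he : 0 ≤ e) (hE : L * e ≤ κ * E)
    (hx : L ^ 2 * α ^ 2 * β ^ 2 * constB ρ < 1 / 62) (hR : R ≤ constB ρ)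
    (hD : a + (1 - α * β) * b ≤ 2 * Δ / α + L * β ^ 2 / n * S + T * (α * β * (c * υ ^ 2)))
    (hS : S ≤ 3 * (ρ ^ 2 * constA ρ) * e
        + 12 * α ^ 2 * (ρ ^ 2 * constA ρ) * (n * L * υ ^ 2) * T
        + 3 * α ^ 2 * R * (β ^ 2 * (8 * L ^ 2 * S
          + 2 * L * n * α ^ 2 * (b + T * (c * υ ^ 2))))) :
    1 / T * a ≤ 1 / constC2' L α β ρ * (2 * Δ / (α * T))
      + 1 / constC2' L α β ρ * (α * c * β * υ ^ 2)
      + κ / (constC1' L α β ρ * constC2' L α β ρ)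
        * (6 * (3 * (1 - ρ ^ 2) ^ 2 + ρ ^ 2) * β ^ 2 / ((1 - ρ ^ 2) ^ 3 * n * T)) * E
      + L ^ 2 / (constC1' L α β ρ * constC2' L α β ρ) * (18 * α ^ 2 * β ^ 2 * υ ^ 2
        * (constA ρ + 3 / 2 * c * α ^ 2 * β ^ 2 * constB ρ)) := by
  have hB := constB_ge_two hρ0 hρ1
  have hL0 : 0 < L := by linarith
  have h1ρ : 0 < 1 - ρ ^ 2 := by nlinarith
  have hA0 : 0 ≤ constA ρ := by rw [constA]; positivity
  have hρA : ρ ^ 2 * constA ρ ≤ constA ρ :=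
    mul_le_of_le_one_left hA0 (pow_le_one₀ hρ0 hρ1.le)
  have hρA0 : 0 ≤ ρ ^ 2 * constA ρ := by positivity
  have hQ := three_mul_sq_mul_constA_le hρ0 hρ1
  obtain ⟨hC1, hC2⟩ := rate_coefficients_pos hx
  have e1 : constC1' L α β ρ = 1 - 60 * (L ^ 2 * α ^ 2 * β ^ 2 * constB ρ) := by
    rw [constC1']; ring
  have e2 : constC2' L α β ρ = 1 - 2 * (L ^ 2 * α ^ 2 * β ^ 2 * constB ρ)
      / (1 - 60 * (L ^ 2 * α ^ 2 * β ^ 2 * constB ρ)) := by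
    rw [constC2', e1]; ring
  rw [e1, e2]
  set A := constA ρ
  set B := constB ρ
  set x := L ^ 2 * α ^ 2 * β ^ 2 * B with hxdef
  set C1 := 1 - 60 * x
  set C2 := 1 - 2 * x / C1
  set Q := 6 * (3 * (1 - ρ ^ 2) ^ 2 + ρ ^ 2) / (1 - ρ ^ 2) ^ 3 with hQdef
  have hx0 : 0 ≤ x := by positivity
  have hC2le : C2 ≤ 1 := by
    have : 0 ≤ 2 * x / C1 := by positivity
    linarith
  have hαβ2 : (α * β) ^ 2 ≤ 1 / 4 := by
    have h1 : (α * β) ^ 2 * 2 ≤ x := by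
      have h2 : 1 ≤ L ^ 2 := one_le_pow₀ hL
      have h3 : 2 ≤ L ^ 2 * B := by nlinarith
      have h4 := mul_le_mul_of_nonneg_left h3 (sq_nonneg (α * β))
      calc (α * β) ^ 2 * 2 ≤ (α * β) ^ 2 * (L ^ 2 * B) := h4
        _ = x := by rw [hxdef]; ring
    linarith
  have hαβ : α * β ≤ 1 / 2 := by nlinarith [mul_pos hα hβ]
  have hC : 0 < 1 - 24 * x := by linarith
  -- The consensus error on the right has coefficient `3 * 8 * x` and is moved to the left.
  have hCS : (1 - 24 * x) * S ≤ 3 * (ρ ^ 2 * A) * e + 12 * α ^ 2 * A * (n * L * υ ^ 2) * T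
      + 6 * L * n * α ^ 4 * β ^ 2 * B * (b + T * (c * υ ^ 2)) := by
    have h1 : 3 * α ^ 2 * R * (β ^ 2 * (8 * L ^ 2 * S
          + 2 * L * n * α ^ 2 * (b + T * (c * υ ^ 2)))) ≤ 3 * α ^ 2 * B * (β ^ 2 * (8 * L ^ 2 * S
          + 2 * L * n * α ^ 2 * (b + T * (c * υ ^ 2)))) := by gcongr
    have h2 : 12 * α ^ 2 * (ρ ^ 2 * A) * (n * L * υ ^ 2) * T
        ≤ 12 * α ^ 2 * A * (n * L * υ ^ 2) * T := by gcongr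
    have h3 : 3 * α ^ 2 * B * (β ^ 2 * (8 * L ^ 2 * S
        + 2 * L * n * α ^ 2 * (b + T * (c * υ ^ 2))))
        = 24 * x * S + 6 * L * n * α ^ 4 * β ^ 2 * B * (b + T * (c * υ ^ 2)) := by
      rw [hxdef]; ring
    linarith
  set U := κ * (Q * β ^ 2 / n) * E
    + L ^ 2 * (18 * α ^ 2 * β ^ 2 * υ ^ 2 * (A + 3 / 2 * c * α ^ 2 * β ^ 2 * B)) * T with hU
  set Z := L * β ^ 2 / n * S with hZ
  have hQ0 : 0 ≤ Q := by positivity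
  have hκE : 0 ≤ κ * E := (mul_nonneg hL0.le he).trans hE
  have hU0 : 0 ≤ U := by
    have : 0 ≤ κ * (Q * β ^ 2 / n) * E := by
      have : κ * (Q * β ^ 2 / n) * E = (κ * E) * (Q * β ^ 2 / n) := by ring
      rw [this]; positivity
    positivity
  have hCZ : (1 - 24 * x) * Z ≤ U + 6 * x * (α * β) ^ 2 * b := by
    have h1 := mul_le_mul_of_nonneg_left hCS (by positivity : 0 ≤ L * β ^ 2 / n)
    have h2 : L * β ^ 2 / n * (3 * (ρ ^ 2 * A) * e + 12 * α ^ 2 * A * (n * L * υ ^ 2) * T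
        + 6 * L * n * α ^ 4 * β ^ 2 * B * (b + T * (c * υ ^ 2)))
        = 3 * (ρ ^ 2 * A) * (β ^ 2 / n) * (L * e) + 12 * (L ^ 2 * α ^ 2 * β ^ 2 * υ ^ 2 * A * T)
          + 6 * (L ^ 2 * α ^ 4 * β ^ 4 * B * υ ^ 2 * c * T) + 6 * x * (α * β) ^ 2 * b := by
      rw [hxdef]; field_simp; ring
    have h3 : 3 * (ρ ^ 2 * A) * (β ^ 2 / n) * (L * e) ≤ Q * (β ^ 2 / n) * (κ * E) := by
      gcongr
    have h4 : 0 ≤ L ^ 2 * α ^ 2 * β ^ 2 * υ ^ 2 * A * T := by positivity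
    have h5 : 0 ≤ L ^ 2 * α ^ 4 * β ^ 4 * B * υ ^ 2 * c * T := by positivity
    have h6 : U = Q * (β ^ 2 / n) * (κ * E) + 18 * (L ^ 2 * α ^ 2 * β ^ 2 * υ ^ 2 * A * T)
        + 27 * (L ^ 2 * α ^ 4 * β ^ 4 * B * υ ^ 2 * c * T) := by rw [hU]; ring
    have h7 : (1 - 24 * x) * Z = L * β ^ 2 / n * ((1 - 24 * x) * S) := by rw [hZ]; ring
    rw [h7, h6]
    linarith
  -- The averaged gradients fed back by the consensus error are paid for by the reserve `1 - α * β`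
  -- from the descent estimate.
  have hbcoef : 6 * x * (α * β) ^ 2 ≤ (1 - 24 * x) * (1 - α * β) := by
    have h1 : x * (α * β) ^ 2 ≤ 1 / 62 * (1 / 4) :=
      mul_le_mul hx.le hαβ2 (sq_nonneg _) (by norm_num)
    have h2 : 38 / 62 * (1 / 2) ≤ (1 - 24 * x) * (1 - α * β) :=
      mul_le_mul (by linarith) (by linarith) (by norm_num) hC.le
    linarith
  have hZle : Z ≤ U / C1 + (1 - α * β) * b := by
    have h1 : (1 - 24 * x) * Z ≤ (1 - 24 * x) * (U / C1 + (1 - α * β) * b) := by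
      have h2 := mul_le_mul_of_nonneg_right hbcoef hb
      have h3 : U ≤ (1 - 24 * x) * (U / C1) := by
        rw [← mul_div_assoc, le_div_iff₀ hC1, mul_comm U]
        exact mul_le_mul_of_nonneg_right (by linarith) hU0
      linarith
    exact le_of_mul_le_mul_left h1 hC
  have ha : a ≤ 2 * Δ / α + T * (α * β * (c * υ ^ 2)) + U / C1 := by linarith
  have hV0 : 0 ≤ 2 * Δ / α + T * (α * β * (c * υ ^ 2)) + U / C1 := by positivity
  calc 1 / T * a ≤ 1 / T * (2 * Δ / α + T * (α * β * (c * υ ^ 2)) + U / C1) := by gcongr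
    -- The estimate already holds without `C2`; the factor `1 / C2 ≥ 1` only weakens it to the
    -- stated form.
    _ ≤ 1 / C2 * (1 / T * (2 * Δ / α + T * (α * β * (c * υ ^ 2)) + U / C1)) :=
        le_mul_of_one_le_left (by positivity) ((one_le_div hC2).2 hC2le)
    _ = _ :=
        rate_regroup hn.ne' hT.ne' hC1.ne' hC2.ne' hα.ne' (by positivity)

/-! ### The rate for general weights -/

section Rate

variable {n d : ℕ} {Ξ Ω : Type*} {f : Fin n → Param d → Ξ → ℝ} {ξ : ℕ → Fin n → Ω → Ξ} {β υ L : ℝ}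
  {G : SimpleGraph (Fin n)} {w m lam : Fin n → ℝ} {W : Matrix (Fin n) (Fin n) ℝ} {α : ℝ}
  {θ₀ : Param d}

/-- The weighted error norm dominates that of the trackers. -/
lemma mul_norm_errY_sq_le {κ : ℝ} (hw : ∀ i, 0 < w i) (hκ : 0 ≤ κ) (hlam : ∀ i, 0 ≤ lam i)
    (hL : ∀ i, L * w i ≤ κ * lam i) (t : ℕ) (ω : Ω) :
    L * ‖errY f w m W α ξ θ₀ t ω‖ ^ 2 ≤ κ * errSq lam (consensusError (lamMat w) α
      (run f W (Matrix.diagonal m) α ξ θ₀ t ω)) := by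
  rw [errY, norm_wEmbed_sq fun i => (hw i).le]
  simp only [errSq, wFrobSq, Fintype.sum_sum_type, consensusError, Sum.elim_inl, Sum.elim_inr]
  rw [mul_add, Finset.mul_sum, Finset.mul_sum (a := κ), Finset.mul_sum (a := κ)]
  refine le_add_of_nonneg_of_le (Finset.sum_nonneg fun i _ =>
    mul_nonneg hκ (mul_nonneg (hlam i) (sq_nonneg _))) (Finset.sum_le_sum fun i _ => ?_)
  rw [← mul_assoc, ← mul_assoc]
  exact mul_le_mul_of_nonneg_right (hL i) (sq_nonneg _)

variable [MeasurableSpace Ξ] [MeasurableSpace Ω] {P : Measure Ω} [IsProbabilityMeasure P]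
  {D : Fin n → Measure Ξ} [∀ i, IsProbabilityMeasure (D i)]

/-- The error is a finite weighted sum of squared norms of linear images of square-integrable
iterates. -/
lemma integrable_errSq_consensusError (hξ : IsSampling P D ξ) (hsm : IsSmooth f D β)
    (hor : IsOracle f D υ) (Gm M : Matrix (Fin n) (Fin n) ℝ) (t : ℕ) :
    Integrable (fun ω => errSq lam (consensusError M α (run f W Gm α ξ θ₀ t ω))) P := by
  simp only [errSq, wFrobSq, Fintype.sum_sum_type, consensusError, Sum.elim_inl, Sum.elim_inr]
  obtain ⟨h1, h2⟩ := memLp_run (W := W) (Gm := Gm) (α := α) (θ₀ := θ₀) hξ hsm hor t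
  exact (integrable_finsetSum _ fun i _ => (integrable_normSq (memLp_act h1 (1 - M) i)).const_mul
    (lam i)).add (integrable_finsetSum _ fun i _ =>
      (integrable_normSq ((memLp_act h2 (1 - M) i).const_smul α)).const_mul (lam i))

variable [NeZero n]

/-- Gradient tracking that mixes with weights `w` and scales gradients by `m`. -/
theorem gradient_tracking_rate (hξ : IsSampling P D ξ) (hsm : IsSmooth f D β)
    (hor : IsOracle f D υ) (hβ : 0 < β) (hα : 0 < α) (hG : G.Connected) (hw : ∀ i, 0 < w i)
    (hwm : ∀ i, w i * m i = lam i) (hm0 : ∀ i, 0 ≤ m i) (hmL : ∀ i, m i ≤ L)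
    (hw_sum : ∑ i, w i = n) (hlam_sum : ∑ i, lam i = n) (hW : IsMixing G w W) {θstar : Param d}
    (hstar : ∀ θ, globalLoss lam f D θstar ≤ globalLoss lam f D θ) {ρ : ℝ}
    (hρ : ρ = specRad (W - lamMat w)) (hstep : α < 1 / (L * β) * √(1 / (62 * constB ρ)))
    {κ E : ℝ} (hE : L * ∫ ω, ‖errY f w m W α ξ θ₀ 0 ω‖ ^ 2 ∂P ≤ κ * E) :
    0 < constC1' L α β ρ ∧ 0 < constC2' L α β ρ ∧ ∀ T : ℕ, 0 < T →
      (1 / (T : ℝ)) * ∑ t ∈ Finset.range T, ∫ ω, ‖gradient (globalLoss lam f D)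
          (wAvg w (run f W (Matrix.diagonal m) α ξ θ₀ t ω).1)‖ ^ 2 ∂P
        ≤ 1 / constC2' L α β ρ * (2 * (globalLoss lam f D θ₀ - globalLoss lam f D θstar) / (α * T))
          + 1 / constC2' L α β ρ * (α * cLam lam * β * υ ^ 2)
          + κ / (constC1' L α β ρ * constC2' L α β ρ)
            * (6 * (3 * (1 - ρ ^ 2) ^ 2 + ρ ^ 2) * β ^ 2 / ((1 - ρ ^ 2) ^ 3 * n * T)) * E
          + L ^ 2 / (constC1' L α β ρ * constC2' L α β ρ) * (18 * α ^ 2 * β ^ 2 * υ ^ 2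
            * (constA ρ + 3 / 2 * cLam lam * α ^ 2 * β ^ 2 * constB ρ)) := by
  have hn : (0 : ℝ) < n := by exact_mod_cast NeZero.pos n
  have hρ0 : 0 ≤ ρ := hρ ▸ specRad_nonneg _
  have hρ1 : ρ < 1 := hρ ▸ hW.specRad_lt_one hG hw hw_sum
  -- Forced by the normalization: both `w` and `lam = w m` sum to `n`.
  have hL : 1 ≤ L := by
    have h : ∑ i, lam i ≤ ∑ i, w i * L := Finset.sum_le_sum fun i _ => by
      rw [← hwm]; exact mul_le_mul_of_nonneg_left (hmL i) (hw i).le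
    rw [← Finset.sum_mul, hw_sum, hlam_sum] at h
    exact le_of_mul_le_mul_left (by linarith) hn
  have hB := constB_ge_two hρ0 hρ1
  have hx := step_size_sq_lt (by linarith) hα hβ (by linarith) hstep
  obtain ⟨hC1, hC2⟩ := rate_coefficients_pos hx
  have e1 : constC1' L α β ρ = 1 - 60 * (L ^ 2 * α ^ 2 * β ^ 2 * constB ρ) := by
    rw [constC1']; ring
  refine ⟨e1 ▸ hC1, ?_, fun T hT => ?_⟩
  · rw [constC2', e1]
    convert hC2 using 3
    ring
  -- The consensus estimate sums over `N + 1` iterations, the first of which has zero error.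
  · obtain ⟨N, rfl⟩ : ∃ N, T = N + 1 := ⟨T - 1, by omega⟩
    have hS := sum_errΘ_sq_le (P := P) (α := α) (θ₀ := θ₀) hξ hsm hor hG hw hwm hm0 hmL hw_sum
      hlam_sum hW hρ N
    have hD := sum_gradient_sq_le (P := P) (θ₀ := θ₀) hξ hsm hor hβ.le hα hw hwm hm0 hmL hw_sum
      hlam_sum hW hstar (N + 1)
    refine rate_of_estimates hn (by positivity) hL hα hβ hρ0 hρ1
      (mul_nonneg (by positivity) (Finset.sum_nonneg fun i _ => sq_nonneg _))
      (Finset.sum_nonneg fun t _ => integral_nonneg fun ω => sq_nonneg _)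
      (Finset.sum_nonneg fun t _ => integral_nonneg fun ω => sq_nonneg _)
      (sub_nonneg.2 (hstar θ₀)) (integral_nonneg fun ω => sq_nonneg _) hE hx
      (sq_resp_gain_le_constB hρ0 hρ1) hD ?_
    push_cast
    exact hS

end Rate

end

end

end WeightedGT

/-! ### The two strategies as special cases -/

open WeightedGT in
theorem mainTheorem1 {n d : ℕ} {Ξ Ω : Type*} [MeasurableSpace Ξ] [MeasurableSpace Ω]
    (P : Measure Ω) [IsProbabilityMeasure P]
    (lam : Fin n → ℝ) (hlam : ∀ i, 0 < lam i) (hlam_sum : ∑ i, lam i = (n : ℝ))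
    (f : Fin n → Param d → Ξ → ℝ) (D : Fin n → Measure Ξ) [∀ i, IsProbabilityMeasure (D i)]
    (ξ : ℕ → Fin n → Ω → Ξ) (hξ : IsSampling P D ξ)
    (β υ : ℝ) (hβ : 0 < β) (hsmooth : IsSmooth f D β) (horacle : IsOracle f D υ)
    (G : SimpleGraph (Fin n)) (hG : G.Connected)
    (θ₀ θstar : Param d) (hstar : ∀ θ, globalLoss lam f D θstar ≤ globalLoss lam f D θ) :
    -- Strategy I
    (∀ Wds : Matrix (Fin n) (Fin n) ℝ, IsMixing G (fun _ => 1) Wds →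
      ∀ ρ : ℝ, ρ = specRad (Wds - avgMat n) →
        ρ < 1 ∧
        ∀ α : ℝ, 0 < α → α < 1 / (lamMax lam * β) * √(1 / (62 * constB ρ)) →
          ∀ C₁ C₂ : ℝ, C₁ = constC1' (lamMax lam) α β ρ → C₂ = constC2' (lamMax lam) α β ρ →
            0 < C₁ ∧ 0 < C₂ ∧
            Integrable (fun ω =>
              errSq lam (consensusError (avgMat n) α (iterI lam f Wds α ξ θ₀ 0 ω))) P ∧
            (∀ t, Integrable (fun ω => ‖gradient (globalLoss lam f D)
              (avg (iterI lam f Wds α ξ θ₀ t ω).1)‖ ^ 2) P) ∧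
            ∀ T : ℕ, 0 < T →
              (1 / (T : ℝ)) * ∑ t ∈ Finset.range T, ∫ ω, ‖gradient (globalLoss lam f D)
                  (avg (iterI lam f Wds α ξ θ₀ t ω).1)‖ ^ 2 ∂P
                ≤ 1 / C₂ * (2 * (globalLoss lam f D θ₀ - globalLoss lam f D θstar) / (α * T))
                  + 1 / C₂ * (α * cLam lam * β * υ ^ 2)
                  + kappa lam / (C₁ * C₂)
                    * (6 * (3 * (1 - ρ ^ 2) ^ 2 + ρ ^ 2) * β ^ 2 / ((1 - ρ ^ 2) ^ 3 * n * T))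
                    * ∫ ω, errSq lam
                        (consensusError (avgMat n) α (iterI lam f Wds α ξ θ₀ 0 ω)) ∂P
                  + lamMax lam ^ 2 / (C₁ * C₂) * (18 * α ^ 2 * β ^ 2 * υ ^ 2
                    * (constA ρ + 3 / 2 * cLam lam * α ^ 2 * β ^ 2 * constB ρ))) ∧
    -- Strategy II
    (∀ W : Matrix (Fin n) (Fin n) ℝ, IsMixing G lam W →
      ∀ ρ : ℝ, ρ = specRad (W - lamMat lam) →
        ρ < 1 ∧
        ∀ α : ℝ, 0 < α → α < 1 / β * √(1 / (62 * constB ρ)) →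
          ∀ C₁ C₂ : ℝ, C₁ = constC1 α β ρ → C₂ = constC2 α β ρ →
            0 < C₁ ∧ 0 < C₂ ∧
            Integrable (fun ω =>
              errSq lam (consensusError (lamMat lam) α (iterII f W α ξ θ₀ 0 ω))) P ∧
            (∀ t, Integrable (fun ω => ‖gradient (globalLoss lam f D)
              (wAvg lam (iterII f W α ξ θ₀ t ω).1)‖ ^ 2) P) ∧
            ∀ T : ℕ, 0 < T →
              (1 / (T : ℝ)) * ∑ t ∈ Finset.range T, ∫ ω, ‖gradient (globalLoss lam f D)
                  (wAvg lam (iterII f W α ξ θ₀ t ω).1)‖ ^ 2 ∂P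
                ≤ 1 / C₂ * (2 * (globalLoss lam f D θ₀ - globalLoss lam f D θstar) / (α * T))
                  + 1 / C₂ * (α * cLam lam * β * υ ^ 2)
                  + 1 / (C₁ * C₂)
                    * (6 * (3 * (1 - ρ ^ 2) ^ 2 + ρ ^ 2) * β ^ 2 / ((1 - ρ ^ 2) ^ 3 * n * T))
                    * ∫ ω, errSq lam
                        (consensusError (lamMat lam) α (iterII f W α ξ θ₀ 0 ω)) ∂P
                  + 1 / (C₁ * C₂) * (18 * α ^ 2 * β ^ 2 * υ ^ 2
                    * (constA ρ + 3 / 2 * cLam lam * α ^ 2 * β ^ 2 * constB ρ))) := by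
  have : Nonempty (Fin n) := hG.nonempty
  have : NeZero n := ⟨fun h => by subst h; exact IsEmpty.false (Classical.arbitrary (Fin 0))⟩
  have hle : ∀ i, lam i ≤ lamMax lam := fun i => le_ciSup (Set.finite_range lam).bddAbove i
  have hmin : ∀ i, lamMin lam ≤ lam i := fun i => ciInf_le (Set.finite_range lam).bddBelow i
  have hmin0 : 0 < lamMin lam := by
    obtain ⟨i, hi⟩ := exists_eq_ciInf_of_finite (f := lam)
    rw [lamMin, ← hi]
    exact hlam i
  have hmax0 : 0 < lamMax lam := (hlam 0).trans_le (hle 0)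
  have hκ0 : 0 ≤ kappa lam := (div_pos hmax0 hmin0).le
  have hM : avgMat n = lamMat fun _ => 1 := by
    ext i j; simp [avgMat, lamMat]
  have havg : ∀ Θ : Fin n → Param d, avg Θ = wAvg (fun _ => 1) Θ := fun Θ => by
    simp [avg, wAvg]
  constructor
  · intro Wds hW ρ hρ
    have hsum1 : ∑ _i : Fin n, (1 : ℝ) = n := by simp
    rw [hM] at hρ
    refine ⟨hρ ▸ hW.specRad_lt_one hG (fun _ => one_pos) hsum1, fun α hα hstep C₁ C₂ hC₁ hC₂ => ?_⟩
    have hrun : ∀ t ω, iterI lam f Wds α ξ θ₀ t ω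
        = run f Wds (Matrix.diagonal lam) α ξ θ₀ t ω := fun t ω => rfl
    have hint := integrable_errSq_consensusError (lam := lam) (W := Wds) (α := α) (θ₀ := θ₀)
      hξ hsmooth horacle (Matrix.diagonal lam) (lamMat fun _ => 1) 0
    -- The factor `kappa lam` enters here: the uniform weights of the mixing are compared with the
    -- norm weighted by `lam`, through `lamMax lam ≤ kappa lam * lam i`.
    have hE : lamMax lam * ∫ ω, ‖errY f (fun _ => 1) lam Wds α ξ θ₀ 0 ω‖ ^ 2 ∂P
        ≤ kappa lam * ∫ ω, errSq lam (consensusError (lamMat fun _ => 1) α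
          (run f Wds (Matrix.diagonal lam) α ξ θ₀ 0 ω)) ∂P := by
      rw [← integral_const_mul, ← integral_const_mul]
      refine integral_mono_of_nonneg (Filter.Eventually.of_forall fun ω =>
        mul_nonneg hmax0.le (sq_nonneg _)) (hint.const_mul _) (Filter.Eventually.of_forall fun ω =>
          mul_norm_errY_sq_le (fun _ => one_pos) hκ0 (fun i => (hlam i).le)
            (fun i => ?_) 0 ω)
      rw [mul_one, kappa, div_mul_eq_mul_div, le_div_iff₀ hmin0]
      exact mul_le_mul_of_nonneg_left (hmin i) hmax0.le
    obtain ⟨h1, h2, h3⟩ := gradient_tracking_rate hξ hsmooth horacle hβ hα hG (fun _ => one_pos)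
      (fun i => one_mul (lam i)) (fun i => (hlam i).le) hle hsum1 hlam_sum hW hstar hρ hstep hE
    subst hC₁ hC₂
    simp only [hrun, havg, hM]
    exact ⟨h1, h2, hint, fun t => integrable_normSq
      (memLp_gradient_globalLoss hξ hsmooth horacle lam _ t), h3⟩
  · intro W hW ρ hρ
    refine ⟨hρ ▸ hW.specRad_lt_one hG hlam hlam_sum, fun α hα hstep C₁ C₂ hC₁ hC₂ => ?_⟩
    have hrun : ∀ t ω, iterII f W α ξ θ₀ t ω
        = run f W (Matrix.diagonal fun _ => 1) α ξ θ₀ t ω := fun t ω => by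
      rw [Matrix.diagonal_one]; rfl
    have hint := integrable_errSq_consensusError (lam := lam) (W := W) (α := α) (θ₀ := θ₀)
      hξ hsmooth horacle (Matrix.diagonal fun _ => 1) (lamMat lam) 0
    -- Mixing weights and norm weights coincide, so no condition number is lost.
    have hE : 1 * ∫ ω, ‖errY f lam (fun _ => 1) W α ξ θ₀ 0 ω‖ ^ 2 ∂P
        ≤ 1 * ∫ ω, errSq lam (consensusError (lamMat lam) α
          (run f W (Matrix.diagonal fun _ => 1) α ξ θ₀ 0 ω)) ∂P := by
      rw [← integral_const_mul, ← integral_const_mul]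
      exact integral_mono_of_nonneg (Filter.Eventually.of_forall fun ω =>
        mul_nonneg zero_le_one (sq_nonneg _)) (hint.const_mul _)
        (Filter.Eventually.of_forall fun ω => mul_norm_errY_sq_le hlam zero_le_one
          (fun i => (hlam i).le) (fun i => le_rfl) 0 ω)
    obtain ⟨h1, h2, h3⟩ := gradient_tracking_rate hξ hsmooth horacle hβ hα hG hlam
      (fun i => mul_one (lam i)) (fun _ => zero_le_one) (fun _ => le_rfl) hlam_sum hlam_sum hW
      hstar hρ (by rwa [one_mul]) hE
    have e1 : constC1' 1 α β ρ = C₁ := by rw [hC₁]; simp [constC1', constC1]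
    have e2 : constC2' 1 α β ρ = C₂ := by rw [hC₂]; simp [constC2', constC2, constC1', constC1]
    rw [e1] at h1
    rw [e2] at h2
    simp only [e1, e2, one_pow] at h3
    simp only [hrun]
    exact ⟨h1, h2, hint, fun t => integrable_normSq
      (memLp_gradient_globalLoss hξ hsmooth horacle lam lam t), h3⟩
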